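/- **Definitions.** For a positive integer $n$, an $n$-adic interval is $J=\left[\frac{k-1}{n^m},\frac{k}{n^m}\right)$ with $m,k\in\mathbb Z$, and its children are $J_j=\left[\frac{k-1}{n^m}+\frac{j-1}{n^{m+1}},\frac{k-1}{n^m}+\frac{j}{n^{m+1}}\right)$, $1\le j\le n$. Let $X=\mathbb R$ or $X=[0,1]$. A measure $\mu$ is *$n$-adic doubling on $X$* if there is a constant $0<C<\infty$ with $\frac1C\le\frac{\mu(J_i)}{\mu(J_j)}\le C$ for any two children $J_i,J_j$ of a common $n$-adic interval $J\subseteq X$ (in particular all these masses are positive and finite). It is *doubling on $X$* if there is a constant $0<C<\infty$ with $\mu(2I)\le C\mu(I)$ for every bounded interval $I$ with $2I\subseteq X$, where $2I$ is the interval with the same midpoint as $I$ and twice its length. Fix a finite set $S$ of positive integers. For $\alpha\ge1$ call an integer $x\ge 1$ *$\alpha$-good* if $$\left|\frac1{2^x}-\frac1{n^{[x\log_n2]}}\right|<\frac{2^{-100\alpha}}{2^x}\qquad\text{for every } n\in S \text{ that is not a power of } 2,$$ where $[\cdot]$ is the closest integer (here $1=2^0$ is a power of $2$). *Reweighting.*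 Let $0<a<1$ and $b=2-a$. To give an interval the weights $(p,q)$ is to multiply the current density by $p$ on its left half and by $q$ on its right half. For $I=\left[l,l+2^{1-x}\right)$ put $Z=l+2^{-x}$ and $H^{(k)}=\left[Z-2^{-k}|I|,Z\right)$, $G^{(k)}=\left[Z,Z+2^{-k}|I|\right)$. The *dyadic Anderson–Hu reweighting* of Lebesgue measure on $I$ in $2\alpha$ steps gives first $I$ the weights $(a,b)$; then $H^{(k)}$ and $G^{(k)}$ the weights $(b,a)$ for $k=1,\dots,\alpha-1$; and then $H^{(k)}$ and $G^{(k)}$ the weights $(a,b)$ for $k=\alpha,\dots,2\alpha-1$. The *compactified reweighting* is for $l=0$ and differs only in the first steps: the density is $1$ on $\left[0,2^{-x-1}\right)$, $a$ on $\left[2^{-x-1},2^{-x}\right)$ and $\frac{3-a}2$ on $\left[2^{-x},2^{1-x}\right)$, and then $G^{(k)}$ is reweighted as above for $k=1,\dots,2\alpha-1$ and $H^{(k)}$ for $k=2,\dots,2\alpha-1$. **Theorem.** Let $n_1,\dots,n_k$ be any finite list of positive integers, $S=\{n_1,\dots,n_k\}$, and let $0<a<1$, $b=2-a$. 1. There is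 an infinite family of locally finite measures on $\mathbb R$, each of which is $n_i$-adic doubling on $\mathbb R$ for every $i$ but not doubling on $\mathbb R$, and each of which is obtained from Lebesgue measure by performing, for every $\alpha\ge1$, the dyadic Anderson–Hu reweighting in $2\alpha$ steps on $I^{(\alpha)}=\left[\alpha,\alpha+2^{1-x_\alpha}\right)$, for some sequence of $\alpha$-good integers $x_\alpha$. 2. There is an infinite family of probability measures on $[0,1]$, each of which is $n_i$-adic doubling on $[0,1]$ for every $i$ but not doubling on $[0,1]$, and each of which is obtained from Lebesgue measure on $[0,1]$ by performing, for every $\alpha\ge1$, the compactified reweighting on $\left[0,2^{1-x_\alpha}\right)$, for some sequence of $\alpha$-good integers $x_\alpha$ with $x_{\alpha+1}\ge x_\alpha+2$. -/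

import Mathlib

open MeasureTheory Set
open scoped ENNReal NNReal

/-- The `n`-adic interval `[(k-1)/n^m, k/n^m)`, with `m` and `k` arbitrary integers. -/
def adicInterval (n : ℕ) (m k : ℤ) : Set ℝ :=
  Ico (((k : ℝ) - 1) / (n : ℝ) ^ m) ((k : ℝ) / (n : ℝ) ^ m)

/-- The `j`-th `n`-adic child, `1 ≤ j ≤ n`, of `[(k-1)/n^m, k/n^m)`. -/
def adicChild (n : ℕ) (m k : ℤ) (j : ℕ) : Set ℝ :=
  Ico (((k : ℝ) - 1) / (n : ℝ) ^ m + ((j : ℝ) - 1) / (n : ℝ) ^ (m + 1))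
    (((k : ℝ) - 1) / (n : ℝ) ^ m + (j : ℝ) / (n : ℝ) ^ (m + 1))

/-- `μ` is `n`-adic doubling on `X` (`X = ℝ` or `X = [0,1]`): the ratio of the masses of two
children of a common `n`-adic interval contained in `X` lies in `[1/C, C]`. The ratio is taken in
`[0,∞]`, where `0/0`, `∞/∞` and `y/∞` are `0`, and `y/0`, `∞/y` are `∞` for `0 < y < ∞`; hence the
two bounds also say that all children have positive and finite mass. -/
def IsAdicDoublingOn (n : ℕ) (X : Set ℝ) (μ : Measure ℝ) : Prop :=
  ∃ C : ℝ≥0, 0 < C ∧ ∀ m k : ℤ, adicInterval n m k ⊆ X →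
    ∀ i ∈ Finset.Icc 1 n, ∀ j ∈ Finset.Icc 1 n,
      (C : ℝ≥0∞)⁻¹ ≤ μ (adicChild n m k i) / μ (adicChild n m k j) ∧
        μ (adicChild n m k i) / μ (adicChild n m k j) ≤ C

/-- `μ` is doubling on `X`: `μ(2I) ≤ C μ(I)` for all bounded intervals `I` (midpoint `c`, length
`2r`) such that the concentric interval `2I` of twice the length lies in `X`. -/
def IsDoublingOn (X : Set ℝ) (μ : Measure ℝ) : Prop :=
  ∃ C : ℝ≥0, 0 < C ∧ ∀ c r : ℝ, 0 < r → Ico (c - 2 * r) (c + 2 * r) ⊆ X →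
    μ (Ico (c - 2 * r) (c + 2 * r)) ≤ C * μ (Ico (c - r) (c + r))

/-- Simultaneous approximation at level `α`: `1/2^x` agrees with `1/n^[x log_n 2]` up to
`2^(-100 α) / 2^x`, for all `n ∈ S` that are not powers of `2`; here `[·]` is the closest
integer. -/
def IsGoodScale (S : Finset ℕ) (α x : ℕ) : Prop :=
  1 ≤ x ∧ ∀ n ∈ S, (¬ ∃ j : ℕ, n = 2 ^ j) →
    |1 / (2 : ℝ) ^ x - 1 / (n : ℝ) ^ (round ((x : ℝ) * Real.logb n 2))|
      < ((2 : ℝ) ^ (100 * α))⁻¹ / (2 : ℝ) ^ x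

noncomputable section

open Classical in
/-- The factor `p` on the left half of `[l, r)`, `q` on the right half, `1` elsewhere.
Multiplying a density that is constant on `[l, r)` by this factor is the redistribution of the
mass of `[l, r)` to its two halves with weights `p` and `q`; it preserves the mass if
`p + q = 2`. -/
def splitWeight (p q l r y : ℝ) : ℝ :=
  if y ∈ Ico l ((l + r) / 2) then p else if y ∈ Ico ((l + r) / 2) r then q else 1

/-- The `k`-th redistribution on `[l, r)`, with `b = 2 - a`: weights `(b, a)` in the first phase
`k < α`, and the reversed weights `(a, b)` in the second phase `α ≤ k`. -/
def phaseWeight (a : ℝ) (α k : ℕ) (l r y : ℝ) : ℝ :=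
  if k < α then splitWeight (2 - a) a l r y else splitWeight a (2 - a) l r y

/-- The dyadic Anderson–Hu density on `I = [l, l + 2/2^x)`, in `2α` steps, with `b = 2 - a` and
distinguished point `Z = l + 1/2^x` (the midpoint of `I`). Step one gives the halves of `I` the
weights `a`, `b`. The following steps, `k = 1, …, 2α - 1`, redistribute the mass of
`H^(k) = [Z - |I|/2^k, Z)` and of `G^(k) = [Z, Z + |I|/2^k)`. So `H^(α)` and `G^(α)` get the
masses `a^α |H^(α)|` and `b^α |G^(α)|`, while the density on `H^(2α)` and `G^(2α)` is `a^α b^α`.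
Nothing is done if `α = 0`. -/
def blockWeight (a l : ℝ) (α x : ℕ) (y : ℝ) : ℝ :=
  if α = 0 then 1 else
    splitWeight a (2 - a) l (l + 2 / 2 ^ x) y *
      (∏ k ∈ Finset.Ico 1 (2 * α),
        phaseWeight a α k (l + 1 / 2 ^ x - 2 / 2 ^ x / 2 ^ k) (l + 1 / 2 ^ x) y) *
      ∏ k ∈ Finset.Ico 1 (2 * α),
        phaseWeight a α k (l + 1 / 2 ^ x) (l + 1 / 2 ^ x + 2 / 2 ^ x / 2 ^ k) y

/-- Lebesgue measure on `ℝ`, reweighted on each `[α, α + 2/2^(x α)) ⊆ [α, α + 1)`,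
`α = 1, 2, …`, by the Anderson–Hu procedure with `2α` steps. -/
def ahMeasure (a : ℝ) (x : ℕ → ℕ) : Measure ℝ :=
  volume.withDensity fun y => ENNReal.ofReal (blockWeight a (⌊y⌋₊ : ℝ) ⌊y⌋₊ (x ⌊y⌋₊) y)

open Classical in
/-- The first step of the compactified procedure on `[0, 2/2^x)`: weight `1` on the first quarter,
which is left for the later blocks, weight `a` on the second quarter, and on the right half the
weight `(3 - a)/2` that makes the total mass unchanged. -/
def compactFirstWeight (a : ℝ) (x : ℕ) (y : ℝ) : ℝ :=
  if y ∈ Ico ((1 / 2 ^ x) / 2) (1 / 2 ^ x : ℝ) then a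
  else if y ∈ Ico (1 / 2 ^ x : ℝ) (2 / 2 ^ x) then (3 - a) / 2 else 1

/-- The compactified density on `[0, 2/2^x)`: the first step is replaced as above, and the
procedure goes on as before, from `H^(2)` (the second quarter) and `G^(1)` (the right half). -/
def compactBlockWeight (a : ℝ) (α x : ℕ) (y : ℝ) : ℝ :=
  if α = 0 then 1 else
    compactFirstWeight a x y *
      (∏ k ∈ Finset.Ico 2 (2 * α),
        phaseWeight a α k (1 / 2 ^ x - 2 / 2 ^ x / 2 ^ k) (1 / 2 ^ x) y) *
      ∏ k ∈ Finset.Ico 1 (2 * α),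
        phaseWeight a α k (1 / 2 ^ x) (1 / 2 ^ x + 2 / 2 ^ x / 2 ^ k) y

/-- Lebesgue measure on `[0,1]`, reweighted on the intervals `[0, 2/2^(x α))`, `α = 1, 2, …`.
For `x (α + 1) ≥ x α + 2` the sets where the factors differ from `1` are disjoint. -/
def ahCompactMeasure (a : ℝ) (x : ℕ → ℕ) : Measure ℝ :=
  (volume.restrict (Icc 0 1)).withDensity fun y =>
    ENNReal.ofReal (∏ᶠ α : ℕ, compactBlockWeight a α (x α) y)

end

/-! Around each distinguished point `Z` the density is, almost everywhere, a function `g` of the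
distance on the right and a function `h` of the distance on the left. Each function changes by a
bounded factor over dyadic shells, has mass up to `d` of order `d` times its value at `d`, and
equals `1` beyond the scale `lam = 2^(-x)` (`SlowlyVarying`, `IsTwoSidedShell`). The two sides drift
apart like `(b / a)^α` before the second phase brings them back together, so they are comparable
again within `δ = lam / 4^α` of `Z`. The constant `4 / a^2` does not depend on `α`.

The drift rules out doubling: adjacent intervals of length about `lam / 2^α` on the two sides of `Z`
have masses of unbounded ratio (`not_isDoublingOn`).

For adic doubling, an `n`-adic interval must not straddle `Z` at the scales of the drift
(`IsTwoSidedShell.childrenComparable`). A good scale puts an `n`-adic point `z + n^(-X)` within `δ`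
of `Z = z + lam`. Intervals of level at least `X` do not cross that point, so they overshoot `Z` by
at most `δ`, where `g` and `h` are interchangeable; hence a single slowly varying function governs
all their children (`SlowlyVarying.exists_subinterval_bounds`). Children of intervals of lower level
have length at least `lam / 2`, and their mass is comparable to their length. Simultaneous
recurrence on a torus supplies scales that are good for all `n` at once (`exists_scale`).

On `ℝ` every unit interval holds at most one block, and children with integer end points are unions
of unit intervals. On `[0,1]` the blocks accumulate at `0`, but their scales are so sparse that an
interval away from `0` meets at most one; intervals starting at `0` are handled by summing over
dyadic shells. The first scale can be recovered from the measure, which makes both families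
infinite. -/

/-! ### Slowly varying densities and the masses of subintervals -/

/-- A density, as a function of the distance to a point, that varies by at most the factor `c` on
each dyadic shell and whose integral up to `d` is controlled by its value at `d`. -/
structure SlowlyVarying (c : ℝ) (v : ℝ → ℝ) : Prop where
  pos : ∀ d, 0 < v d
  dyadic : ∀ d e, 0 < d → d ≤ e → e ≤ 2 * d → v d ≤ c * v e ∧ v e ≤ c * v d
  mass : ∀ d, 0 < d → ∫⁻ t in Ioc 0 d, ENNReal.ofReal (v t) ≤ ENNReal.ofReal (c * d * v d)

theorem SlowlyVarying.iterate {c : ℝ} {v : ℝ → ℝ} (hv : SlowlyVarying c v) (hc : 1 ≤ c) (k : ℕ) :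
    ∀ d e, 0 < d → d ≤ e → e ≤ 2 ^ k * d → v d ≤ c ^ k * v e ∧ v e ≤ c ^ k * v d := by
  induction k with
  | zero =>
    intro d e hd h1 h2
    have : d = e := le_antisymm h1 (by simpa using h2)
    simp [this]
  | succ k ih =>
    intro d e hd h1 h2
    have hck : 1 ≤ c ^ k := one_le_pow₀ hc
    rcases le_total e (2 * d) with h | h
    · obtain ⟨h3, h4⟩ := hv.dyadic d e hd h1 h
      have := hv.pos d
      have := hv.pos e
      constructor
      · calc v d ≤ 1 * (c * v e) := by linarith
          _ ≤ c ^ k * (c * v e) := by gcongr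
          _ = c ^ (k + 1) * v e := by ring
      · calc v e ≤ 1 * (c * v d) := by linarith
          _ ≤ c ^ k * (c * v d) := by gcongr
          _ = c ^ (k + 1) * v d := by ring
    · obtain ⟨h3, h4⟩ := hv.dyadic d (2 * d) hd (by linarith) le_rfl
      obtain ⟨h5, h6⟩ := ih (2 * d) e (by linarith) h (by rw [pow_succ] at h2; linarith)
      constructor
      · calc v d ≤ c * v (2 * d) := h3
          _ ≤ c * (c ^ k * v e) := by gcongr
          _ = c ^ (k + 1) * v e := by ring
      · calc v e ≤ c ^ k * v (2 * d) := h6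
          _ ≤ c ^ k * (c * v d) := by gcongr
          _ = c ^ (k + 1) * v d := by ring

theorem setLIntegral_Ioc_sub_right (f : ℝ → ℝ≥0∞) (Z d : ℝ) :
    ∫⁻ y in Ioc Z (Z + d), f (y - Z) = ∫⁻ t in Ioc 0 d, f t := by
  rw [← lintegral_indicator measurableSet_Ioc, ← lintegral_indicator measurableSet_Ioc,
    ← lintegral_sub_right_eq_self ((Ioc 0 d).indicator f) Z]
  congr 1
  ext y
  simp only [indicator, mem_Ioc, sub_pos, sub_le_iff_le_add']

theorem setLIntegral_Ico_sub_left (f : ℝ → ℝ≥0∞) (Z d : ℝ) :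
    ∫⁻ y in Ico (Z - d) Z, f (Z - y) = ∫⁻ t in Ioc 0 d, f t := by
  rw [← lintegral_indicator measurableSet_Ico, ← lintegral_indicator measurableSet_Ioc,
    ← lintegral_sub_left_eq_self ((Ioc 0 d).indicator f) Z]
  congr 1
  ext y
  have : (Z - d ≤ y ∧ y < Z) ↔ (y < Z ∧ Z - y ≤ d) := by
    constructor <;> rintro ⟨h1, h2⟩ <;> constructor <;> linarith
  simp only [indicator, mem_Ico, mem_Ioc, sub_pos, this]

theorem setLIntegral_le_of_ae_le {w : ℝ → ℝ} {K : Set ℝ} {b s t : ℝ} (hb : 0 ≤ b)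
    (hK : K ⊆ Ico s t) (hm : MeasurableSet K) (h : ∀ᵐ y, y ∈ K → w y ≤ b) :
    ∫⁻ y in K, ENNReal.ofReal (w y) ≤ ENNReal.ofReal (b * (t - s)) := by
  calc ∫⁻ y in K, ENNReal.ofReal (w y) ≤ ∫⁻ _ in K, ENNReal.ofReal b :=
        setLIntegral_mono_ae' hm (h.mono fun y hy hyK => ENNReal.ofReal_le_ofReal (hy hyK))
    _ ≤ ∫⁻ _ in Ico s t, ENNReal.ofReal b := lintegral_mono_set hK
    _ = ENNReal.ofReal (b * (t - s)) := by
      rw [setLIntegral_const, Real.volume_Ico, ENNReal.ofReal_mul hb]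

theorem le_setLIntegral_of_ae_le {w : ℝ → ℝ} {K : Set ℝ} {b s t : ℝ} (hb : 0 ≤ b)
    (hK : Ico s t ⊆ K) (h : ∀ᵐ y, y ∈ Ico s t → b ≤ w y) :
    ENNReal.ofReal (b * (t - s)) ≤ ∫⁻ y in K, ENNReal.ofReal (w y) := by
  calc ENNReal.ofReal (b * (t - s)) = ∫⁻ _ in Ico s t, ENNReal.ofReal b := by
        rw [setLIntegral_const, Real.volume_Ico, ENNReal.ofReal_mul hb]
    _ ≤ ∫⁻ y in Ico s t, ENNReal.ofReal (w y) :=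
        setLIntegral_mono_ae' measurableSet_Ico
          (h.mono fun y hy hyK => ENNReal.ofReal_le_ofReal (hy hyK))
    _ ≤ _ := lintegral_mono_set hK

/-- An interval contains a quarter of itself that keeps the distance of a quarter of its length
from a given point. -/
theorem exists_quarter_away (Z s ℓ : ℝ) (hℓ : 0 < ℓ) :
    ∃ u, Ico u (u + ℓ / 4) ⊆ Ico s (s + ℓ) ∧ ∀ y ∈ Ico u (u + ℓ / 4), ℓ / 4 ≤ |y - Z| := by
  rcases le_total Z (s + ℓ / 2) with h | h
  · refine ⟨s + 3 * ℓ / 4, Ico_subset_Ico (by linarith) (by linarith), fun y hy => ?_⟩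
    exact le_trans (by linarith [hy.1]) (le_abs_self _)
  · refine ⟨s, Ico_subset_Ico le_rfl (by linarith), fun y hy => ?_⟩
    exact le_trans (by linarith [hy.2]) (neg_le_abs _)

/-- The field `mass` is essential here: the shell condition alone would allow a non-integrable
blow-up at distance `0`. -/
theorem SlowlyVarying.mass_symm {c : ℝ} {v : ℝ → ℝ} (hv : SlowlyVarying c v) (hc : 1 ≤ c)
    (Z d : ℝ) (hd : 0 < d) :
    ∫⁻ y in Icc (Z - d) (Z + d), ENNReal.ofReal (v |y - Z|) ≤
      ENNReal.ofReal (2 * (c * d * v d)) := by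
  have hsub : Icc (Z - d) (Z + d) ⊆ Ico (Z - d) Z ∪ ({Z} ∪ Ioc Z (Z + d)) := by
    intro y hy
    rcases lt_trichotomy y Z with h | h | h
    · exact Or.inl ⟨hy.1, h⟩
    · exact Or.inr (Or.inl h)
    · exact Or.inr (Or.inr ⟨h, hy.2⟩)
  have hp := hv.pos d
  calc ∫⁻ y in Icc (Z - d) (Z + d), ENNReal.ofReal (v |y - Z|)
      ≤ ∫⁻ y in Ico (Z - d) Z ∪ ({Z} ∪ Ioc Z (Z + d)), ENNReal.ofReal (v |y - Z|) :=
        lintegral_mono_set hsub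
    _ ≤ (∫⁻ y in Ico (Z - d) Z, ENNReal.ofReal (v |y - Z|)) +
        ((∫⁻ y in {Z}, ENNReal.ofReal (v |y - Z|)) +
          ∫⁻ y in Ioc Z (Z + d), ENNReal.ofReal (v |y - Z|)) :=
        (lintegral_union_le _ _ _).trans (by gcongr; exact lintegral_union_le _ _ _)
    _ = (∫⁻ y in Ico (Z - d) Z, ENNReal.ofReal (v (Z - y))) +
          ∫⁻ y in Ioc Z (Z + d), ENNReal.ofReal (v (y - Z)) := by
        congr 1
        · refine setLIntegral_congr_fun measurableSet_Ico fun y hy => ?_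
          simp only [abs_sub_comm y Z, abs_of_pos (sub_pos.2 hy.2)]
        · rw [Measure.restrict_singleton]
          simp only [Real.volume_singleton, zero_smul, lintegral_zero_measure, zero_add]
          refine setLIntegral_congr_fun measurableSet_Ioc fun y hy => ?_
          simp only [abs_of_pos (sub_pos.2 hy.1)]
    _ ≤ ENNReal.ofReal (c * d * v d) + ENNReal.ofReal (c * d * v d) := by
        rw [setLIntegral_Ico_sub_left (fun t => ENNReal.ofReal (v t)),
          setLIntegral_Ioc_sub_right (fun t => ENNReal.ofReal (v t))]
        exact add_le_add (hv.mass d hd) (hv.mass d hd)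
    _ = ENNReal.ofReal (2 * (c * d * v d)) := by
        rw [← ENNReal.ofReal_add (by positivity) (by positivity), two_mul]

/-- A density comparable to a slowly varying function of the distance to a point gives comparable
masses to all subintervals of relative length `1 / n`. -/
theorem SlowlyVarying.exists_subinterval_bounds {c : ℝ} {v : ℝ → ℝ} (hv : SlowlyVarying c v)
    (hc : 1 ≤ c) {w : ℝ → ℝ} {Z s ℓ : ℝ} (hℓ : 0 < ℓ) {n : ℕ} (hn : 1 ≤ n)
    (hw : ∀ᵐ y, y ∈ Ico s (s + ℓ) → w y ≤ c * v |y - Z| ∧ v |y - Z| ≤ c * w y) :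
    ∃ V, 0 < V ∧ ∀ u, Ico u (u + ℓ / n) ⊆ Ico s (s + ℓ) →
      ENNReal.ofReal V ≤ ∫⁻ y in Ico u (u + ℓ / n), ENNReal.ofReal (w y) ∧
      ∫⁻ y in Ico u (u + ℓ / n), ENNReal.ofReal (w y) ≤
        ENNReal.ofReal (16 * n * c ^ (n + 6) * V) := by
  have hc0 : 0 < c := by linarith
  have hn' : (1 : ℝ) ≤ n := by exact_mod_cast hn
  have hn0 : (0 : ℝ) < n := by linarith
  have hin : ∀ y ∈ Ico s (s + ℓ), |y - Z| ≤ max |s - Z| |s + ℓ - Z| := fun y hy => by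
    rw [abs_le]
    constructor
    · have := neg_abs_le (s - Z)
      have := le_max_left |s - Z| |s + ℓ - Z|
      linarith [hy.1]
    · have := le_abs_self (s + ℓ - Z)
      have := le_max_right |s - Z| |s + ℓ - Z|
      linarith [hy.2]
  set D := max |s - Z| |s + ℓ - Z| with hD
  rcases le_or_gt (2 * ℓ) D with hcase | hcase
  -- Far from `Z`: all distances lie in `[D / 2, D]`, a single doubling, so `w` is constant up to
  -- the factor `c ^ 2` in both directions.
  · have hD0 : 0 < D := by linarith
    have hlow : ∀ y ∈ Ico s (s + ℓ), D / 2 ≤ |y - Z| := fun y hy => by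
      have h1 : |s - Z| ≤ |y - Z| + ℓ := by
        have : |s - Z| ≤ |s - y| + |y - Z| := abs_sub_le _ _ _
        have : |s - y| ≤ ℓ := by rw [abs_le]; constructor <;> linarith [hy.1, hy.2]
        linarith
      have h2 : |s + ℓ - Z| ≤ |y - Z| + ℓ := by
        have : |s + ℓ - Z| ≤ |s + ℓ - y| + |y - Z| := abs_sub_le _ _ _
        have : |s + ℓ - y| ≤ ℓ := by rw [abs_le]; constructor <;> linarith [hy.1, hy.2]
        linarith
      have : D ≤ |y - Z| + ℓ := max_le h1 h2
      linarith
    have hvD := hv.pos D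
    have hcomp : ∀ᵐ y, y ∈ Ico s (s + ℓ) → w y ≤ c ^ 2 * v D ∧ v D / c ^ 2 ≤ w y := by
      filter_upwards [hw] with y hy hyJ
      obtain ⟨h1, h2⟩ := hy hyJ
      have hl := hlow y hyJ
      obtain ⟨h3, h4⟩ := hv.dyadic |y - Z| D (by linarith) (hin y hyJ) (by linarith)
      constructor
      · calc w y ≤ c * v |y - Z| := h1
          _ ≤ c * (c * v D) := by gcongr
          _ = c ^ 2 * v D := by ring
      · rw [div_le_iff₀ (by positivity)]
        calc v D ≤ c * v |y - Z| := h4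
          _ ≤ c * (c * w y) := by gcongr
          _ = w y * c ^ 2 := by ring
    refine ⟨v D / c ^ 2 * (ℓ / n), by positivity, fun u hu => ⟨?_, ?_⟩⟩
    · have := le_setLIntegral_of_ae_le (w := w) (b := v D / c ^ 2) (by positivity) subset_rfl
        (hcomp.mono fun y hy hyK => (hy (hu hyK)).2)
      simpa using this
    · have := setLIntegral_le_of_ae_le (w := w) (b := c ^ 2 * v D) (s := u) (t := u + ℓ / n)
        (by positivity) subset_rfl measurableSet_Ico
        (hcomp.mono fun y hy hyK => (hy (hu hyK)).1)
      refine this.trans (ENNReal.ofReal_le_ofReal ?_)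
      have h1 : c ^ 4 ≤ 16 * n * c ^ (n + 6) := by
        calc c ^ 4 ≤ c ^ (n + 6) := pow_le_pow_right₀ hc (by omega)
          _ = 1 * c ^ (n + 6) := by ring
          _ ≤ 16 * n * c ^ (n + 6) := by gcongr; linarith
      calc c ^ 2 * v D * (u + ℓ / n - u) = c ^ 4 * (v D / c ^ 2 * (ℓ / n)) := by
            field_simp; ring
        _ ≤ _ := by gcongr
  -- Near `Z`: everything is compared with `v (2 * ℓ)`. The upper bound uses the mass of `v` within
  -- `2 * ℓ` of `Z`. The lower bound uses a quarter of the subinterval at distance at least `ℓ / (4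
  -- * n)` from `Z`, from which `n + 3` doublings reach `2 * ℓ`.
  · have hvL := hv.pos (2 * ℓ)
    refine ⟨v (2 * ℓ) / c ^ (n + 4) * (ℓ / n / 4), by positivity, fun u hu => ⟨?_, ?_⟩⟩
    · obtain ⟨u', hu', hfar⟩ := exists_quarter_away Z u (ℓ / n) (by positivity)
      have := le_setLIntegral_of_ae_le (w := w) (b := v (2 * ℓ) / c ^ (n + 4)) (by positivity) hu'
        (hw.mono fun y hy hyK => by
          have hyJ := hu (hu' hyK)
          have h1 := hfar y hyK
          have h0 : 0 < ℓ / n / 4 := by positivity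
          have h2 : 2 * ℓ ≤ 2 ^ (n + 3) * |y - Z| := by
            have : (n : ℝ) ≤ 2 ^ n := by exact_mod_cast (Nat.lt_two_pow_self).le
            calc 2 * ℓ = n * 8 * (ℓ / n / 4) := by field_simp; ring
              _ ≤ 2 ^ n * 8 * |y - Z| := by gcongr
              _ = 2 ^ (n + 3) * |y - Z| := by ring
          have h3 := (hv.iterate hc (n + 3) |y - Z| (2 * ℓ) (by linarith)
            ((hin y hyJ).trans hcase.le) h2).2
          rw [div_le_iff₀ (by positivity)]
          calc v (2 * ℓ) ≤ c ^ (n + 3) * v |y - Z| := h3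
            _ ≤ c ^ (n + 3) * (c * w y) := by gcongr; exact (hy hyJ).2
            _ = w y * c ^ (n + 4) := by ring)
      simpa using this
    · calc ∫⁻ y in Ico u (u + ℓ / n), ENNReal.ofReal (w y)
          ≤ ∫⁻ y in Ico u (u + ℓ / n), ENNReal.ofReal c * ENNReal.ofReal (v |y - Z|) := by
            refine setLIntegral_mono_ae' measurableSet_Ico (hw.mono fun y hy hyK => ?_)
            rw [← ENNReal.ofReal_mul hc0.le]
            exact ENNReal.ofReal_le_ofReal (hy (hu hyK)).1
        _ = ENNReal.ofReal c * ∫⁻ y in Ico u (u + ℓ / n), ENNReal.ofReal (v |y - Z|) :=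
            lintegral_const_mul' _ _ ENNReal.ofReal_ne_top
        _ ≤ ENNReal.ofReal c *
            ∫⁻ y in Icc (Z - 2 * ℓ) (Z + 2 * ℓ), ENNReal.ofReal (v |y - Z|) := by
            gcongr
            intro y hy
            have := abs_le.1 ((hin y (hu hy)).trans hcase.le)
            constructor <;> linarith [this.1, this.2]
        _ ≤ ENNReal.ofReal c * ENNReal.ofReal (2 * (c * (2 * ℓ) * v (2 * ℓ))) := by
            gcongr
            exact hv.mass_symm hc Z (2 * ℓ) (by linarith)
        _ = ENNReal.ofReal (16 * n * c ^ (n + 6) * (v (2 * ℓ) / c ^ (n + 4) * (ℓ / n / 4))) := by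
            rw [← ENNReal.ofReal_mul hc0.le]
            congr 1
            rw [show c ^ (n + 6) = c ^ (n + 4) * c ^ 2 by ring]
            field_simp
            ring

/-! ### Densities with different profiles on the two sides of a point -/

/-- The density `w` on the region `R` is given by slowly varying functions of the distance to `Z`
on either side of `Z`; both are `1` beyond `lam`, and they are comparable up to `δ`. -/
structure IsTwoSidedShell (c Z lam δ : ℝ) (w g h : ℝ → ℝ) (R : Set ℝ) : Prop where
  right : SlowlyVarying c g
  left : SlowlyVarying c h
  right_far : ∀ d, lam < d → g d = 1
  left_far : ∀ d, lam < d → h d = 1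
  right_eq : ∀ᵐ y, y ∈ R → Z ≤ y → w y = g (y - Z)
  left_eq : ∀ᵐ y, y ∈ R → y < Z → w y = h (Z - y)
  core : ∀ d ≤ δ, g d ≤ c * h d ∧ h d ≤ c * g d

namespace IsTwoSidedShell

variable {c Z lam δ : ℝ} {w g h : ℝ → ℝ} {R : Set ℝ}

/-- To the left of `Z` the interval reaches only distances at most `δ`, where `core` exchanges `h`
for `g`; so `g (|y - Z|)` describes the density on the whole interval. -/
theorem exists_bounds_of_right (H : IsTwoSidedShell c Z lam δ w g h R) (hc : 1 ≤ c)
    {s ℓ : ℝ} (hℓ : 0 < ℓ) {n : ℕ} (hn : 1 ≤ n) (hR : Ico s (s + ℓ) ⊆ R) (hs : Z - δ ≤ s) :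
    ∃ V, 0 < V ∧ ∀ u, Ico u (u + ℓ / n) ⊆ Ico s (s + ℓ) →
      ENNReal.ofReal V ≤ ∫⁻ y in Ico u (u + ℓ / n), ENNReal.ofReal (w y) ∧
      ∫⁻ y in Ico u (u + ℓ / n), ENNReal.ofReal (w y) ≤
        ENNReal.ofReal (16 * n * c ^ (n + 6) * V) := by
  refine H.right.exists_subinterval_bounds (Z := Z) hc hℓ hn ?_
  filter_upwards [H.right_eq, H.left_eq] with y h1 h2 hy
  rcases le_or_gt Z y with hZ | hZ
  · rw [h1 (hR hy) hZ, abs_of_nonneg (sub_nonneg.2 hZ)]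
    have := H.right.pos (y - Z)
    constructor <;> nlinarith
  · rw [h2 (hR hy) hZ, abs_sub_comm, abs_of_pos (sub_pos.2 hZ)]
    exact (H.core (Z - y) (by linarith [hy.1])).symm

theorem exists_bounds_of_left (H : IsTwoSidedShell c Z lam δ w g h R) (hc : 1 ≤ c)
    {s ℓ : ℝ} (hℓ : 0 < ℓ) {n : ℕ} (hn : 1 ≤ n) (hR : Ico s (s + ℓ) ⊆ R) (hs : s + ℓ ≤ Z + δ) :
    ∃ V, 0 < V ∧ ∀ u, Ico u (u + ℓ / n) ⊆ Ico s (s + ℓ) →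
      ENNReal.ofReal V ≤ ∫⁻ y in Ico u (u + ℓ / n), ENNReal.ofReal (w y) ∧
      ∫⁻ y in Ico u (u + ℓ / n), ENNReal.ofReal (w y) ≤
        ENNReal.ofReal (16 * n * c ^ (n + 6) * V) := by
  refine H.left.exists_subinterval_bounds (Z := Z) hc hℓ hn ?_
  filter_upwards [H.right_eq, H.left_eq] with y h1 h2 hy
  rcases le_or_gt Z y with hZ | hZ
  · rw [h1 (hR hy) hZ, abs_of_nonneg (sub_nonneg.2 hZ)]
    exact H.core (y - Z) (by linarith [hy.2])
  · rw [h2 (hR hy) hZ, abs_sub_comm, abs_of_pos (sub_pos.2 hZ)]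
    have := H.left.pos (Z - y)
    constructor <;> nlinarith

/-- The mass of an interval that is not short compared with `lam` is bounded below by its
length. -/
theorem le_mass (H : IsTwoSidedShell c Z lam δ w g h R) (hc : 1 ≤ c) {s ℓ : ℝ} (hℓ : 0 < ℓ)
    (hR : Ico s (s + ℓ) ⊆ R) {k : ℕ} (hk : 4 * lam < 2 ^ k * ℓ) :
    ENNReal.ofReal (ℓ / (4 * c ^ k)) ≤ ∫⁻ y in Ico s (s + ℓ), ENNReal.ofReal (w y) := by
  -- From distance at least `ℓ / 4`, `k` doublings lead beyond `lam`, where the profile is `1`; each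
  -- costs at most a factor `c`.
  have hfar : ∀ v : ℝ → ℝ, SlowlyVarying c v → (∀ d, lam < d → v d = 1) → ∀ d, ℓ / 4 ≤ d →
      1 / c ^ k ≤ v d := fun v hv hv1 d hd => by
    have h2 : (1 : ℝ) ≤ 2 ^ k := one_le_pow₀ (by norm_num)
    have hd0 : 0 < d := by linarith
    have h1 := (hv.iterate hc k d (2 ^ k * d) hd0 (by nlinarith) le_rfl).2
    have h3 : lam < 2 ^ k * d := by nlinarith
    rw [hv1 _ h3] at h1
    rw [div_le_iff₀ (by positivity)]
    linarith
  obtain ⟨u, hu, hq⟩ := exists_quarter_away Z s ℓ hℓ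
  have := le_setLIntegral_of_ae_le (w := w) (b := 1 / c ^ k) (by positivity) hu (by
    filter_upwards [H.right_eq, H.left_eq] with y h1 h2 hy
    have hq' := hq y hy
    rcases le_or_gt Z y with hZ | hZ
    · rw [h1 (hR (hu hy)) hZ]
      rw [abs_of_nonneg (sub_nonneg.2 hZ)] at hq'
      exact hfar g H.right H.right_far _ hq'
    · rw [h2 (hR (hu hy)) hZ]
      rw [abs_sub_comm, abs_of_pos (sub_pos.2 hZ)] at hq'
      exact hfar h H.left H.left_far _ hq')
  convert this using 2
  field_simp
  ring

/-- Farther than `2 * lam` from `Z` the density is `1`. Nearer, each side contributes at most `4 * c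
* lam`, by `mass_symm` at `2 * lam`, where the profile is already `1`. -/
theorem mass_le (H : IsTwoSidedShell c Z lam δ w g h R) (hc : 1 ≤ c) (hlam : 0 < lam) {s ℓ : ℝ}
    (hℓ : 0 ≤ ℓ) (hR : Ico s (s + ℓ) ⊆ R) :
    ∫⁻ y in Ico s (s + ℓ), ENNReal.ofReal (w y) ≤ ENNReal.ofReal (ℓ + 8 * c * lam) := by
  set K := Ico s (s + ℓ) with hK
  have hmass : ∀ v : ℝ → ℝ, SlowlyVarying c v → (∀ d, lam < d → v d = 1) →
      ∫⁻ t in Icc (Z - 2 * lam) (Z + 2 * lam), ENNReal.ofReal (v |t - Z|) ≤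
        ENNReal.ofReal (4 * c * lam) := fun v hv hv1 => by
    refine (hv.mass_symm hc Z (2 * lam) (by linarith)).trans (ENNReal.ofReal_le_ofReal ?_)
    rw [hv1 _ (by linarith)]
    linarith
  set B := Icc (Z - 2 * lam) (Z + 2 * lam) with hB
  have hsub : K ⊆ (K \ B) ∪ ((K ∩ B ∩ Ici Z) ∪ (K ∩ B ∩ Iio Z)) := by
    intro y hy
    by_cases hyB : y ∈ B
    · rcases le_or_gt Z y with hZ | hZ
      · exact Or.inr (Or.inl ⟨⟨hy, hyB⟩, hZ⟩)
      · exact Or.inr (Or.inr ⟨⟨hy, hyB⟩, hZ⟩)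
    · exact Or.inl ⟨hy, hyB⟩
  have hKm : MeasurableSet K := measurableSet_Ico
  have hBm : MeasurableSet B := measurableSet_Icc
  have e1 : ∫⁻ y in K \ B, ENNReal.ofReal (w y) ≤ ENNReal.ofReal ℓ := by
    have := setLIntegral_le_of_ae_le (w := w) (b := 1) (s := s) (t := s + ℓ) zero_le_one
      (K := K \ B) sdiff_subset (hKm.diff hBm) (by
        filter_upwards [H.right_eq, H.left_eq] with y h1 h2 hy
        rcases le_or_gt Z y with hZ | hZ
        · rw [h1 (hR hy.1) hZ, H.right_far]
          by_contra hcon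
          exact hy.2 ⟨by linarith, by linarith⟩
        · rw [h2 (hR hy.1) hZ, H.left_far]
          by_contra hcon
          exact hy.2 ⟨by linarith, by linarith⟩)
    simpa using this
  have e2 : ∫⁻ y in K ∩ B ∩ Ici Z, ENNReal.ofReal (w y) ≤ ENNReal.ofReal (4 * c * lam) := by
    refine le_trans ?_ (hmass g H.right H.right_far)
    refine le_trans (setLIntegral_mono_ae' ((hKm.inter hBm).inter measurableSet_Ici)
      (g := fun t => ENNReal.ofReal (g |t - Z|)) ?_)
      (lintegral_mono_set fun y hy => hy.1.2)
    filter_upwards [H.right_eq] with y h1 hy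
    rw [h1 (hR hy.1.1) hy.2, abs_of_nonneg (sub_nonneg.2 hy.2)]
  have e3 : ∫⁻ y in K ∩ B ∩ Iio Z, ENNReal.ofReal (w y) ≤ ENNReal.ofReal (4 * c * lam) := by
    refine le_trans ?_ (hmass h H.left H.left_far)
    refine le_trans (setLIntegral_mono_ae' ((hKm.inter hBm).inter measurableSet_Iio)
      (g := fun t => ENNReal.ofReal (h |t - Z|)) ?_)
      (lintegral_mono_set fun y hy => hy.1.2)
    filter_upwards [H.left_eq] with y h1 hy
    rw [h1 (hR hy.1.1) hy.2, abs_sub_comm, abs_of_pos (sub_pos.2 hy.2)]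
  calc ∫⁻ y in K, ENNReal.ofReal (w y)
      ≤ ∫⁻ y in (K \ B) ∪ ((K ∩ B ∩ Ici Z) ∪ (K ∩ B ∩ Iio Z)), ENNReal.ofReal (w y) :=
        lintegral_mono_set hsub
    _ ≤ ENNReal.ofReal ℓ + (ENNReal.ofReal (4 * c * lam) + ENNReal.ofReal (4 * c * lam)) :=
        (lintegral_union_le _ _ _).trans
          (add_le_add e1 ((lintegral_union_le _ _ _).trans (add_le_add e2 e3)))
    _ = ENNReal.ofReal (ℓ + 8 * c * lam) := by
        rw [← ENNReal.ofReal_add (by positivity) (by positivity),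
          ← ENNReal.ofReal_add (by positivity) (by positivity)]
        congr 1
        ring

end IsTwoSidedShell

/-! ### Adic intervals and the comparison of children -/

theorem adicInterval_eq (n : ℕ) (m k : ℤ) :
    adicInterval n m k =
      Ico (((k : ℝ) - 1) / (n : ℝ) ^ m) (((k : ℝ) - 1) / (n : ℝ) ^ m + ((n : ℝ) ^ m)⁻¹) := by
  rw [adicInterval]
  congr 1
  ring

theorem adicChild_eq {n : ℕ} (hn : 0 < n) (m k : ℤ) (j : ℕ) :
    adicChild n m k j =
      Ico (((k : ℝ) - 1) / (n : ℝ) ^ m + ((j : ℝ) - 1) / (n : ℝ) ^ (m + 1))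
        (((k : ℝ) - 1) / (n : ℝ) ^ m + ((j : ℝ) - 1) / (n : ℝ) ^ (m + 1) +
          ((n : ℝ) ^ m)⁻¹ / n) := by
  have : (n : ℝ) ≠ 0 := by positivity
  rw [adicChild, zpow_add_one₀ this]
  congr 1
  field_simp
  ring

theorem adicChild_subset {n : ℕ} (hn : 0 < n) (m k : ℤ) {j : ℕ} (hj : j ∈ Finset.Icc 1 n) :
    adicChild n m k j ⊆ adicInterval n m k := by
  obtain ⟨h1, h2⟩ := Finset.mem_Icc.1 hj
  have h1' : (1 : ℝ) ≤ j := by exact_mod_cast h1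
  have h2' : (j : ℝ) ≤ n := by exact_mod_cast h2
  have hn' : (0 : ℝ) < n := by exact_mod_cast hn
  have hp : 0 < (n : ℝ) ^ m := by positivity
  rw [adicInterval_eq, adicChild_eq hn, zpow_add_one₀ hn'.ne']
  refine Ico_subset_Ico ?_ ?_
  · have : 0 ≤ ((j : ℝ) - 1) / ((n : ℝ) ^ m * n) := div_nonneg (by linarith) (by positivity)
    linarith
  · have : ((j : ℝ) - 1) / ((n : ℝ) ^ m * n) + ((n : ℝ) ^ m)⁻¹ / n = (j / n) * ((n : ℝ) ^ m)⁻¹ := by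
      field_simp
      ring
    rw [add_assoc, this]
    gcongr
    have : (j : ℝ) / n ≤ 1 := by rw [div_le_one hn']; exact h2'
    calc (j : ℝ) / n * ((n : ℝ) ^ m)⁻¹ ≤ 1 * ((n : ℝ) ^ m)⁻¹ := by gcongr
      _ = _ := one_mul _

/-- All children of `[(k-1)/n^m, k/n^m)` have their mass between `V` and `C V`, for some `V > 0`
that may depend on the interval. -/
def ChildrenComparable (C : ℝ) (n : ℕ) (m k : ℤ) (μ : Measure ℝ) : Prop :=
  ∃ V, 0 < V ∧ ∀ j ∈ Finset.Icc 1 n, ENNReal.ofReal V ≤ μ (adicChild n m k j) ∧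
    μ (adicChild n m k j) ≤ ENNReal.ofReal (C * V)

theorem ChildrenComparable.mono {C D : ℝ} (hCD : C ≤ D) {n : ℕ} {m k : ℤ} {μ : Measure ℝ}
    (h : ChildrenComparable C n m k μ) : ChildrenComparable D n m k μ := by
  obtain ⟨V, hV, h⟩ := h
  exact ⟨V, hV, fun j hj => ⟨(h j hj).1, (h j hj).2.trans (ENNReal.ofReal_le_ofReal (by gcongr))⟩⟩

theorem isAdicDoublingOn_of_childrenComparable {C : ℝ} (hC : 0 < C) {n : ℕ} {X : Set ℝ}
    {μ : Measure ℝ}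
    (h : ∀ m k : ℤ, adicInterval n m k ⊆ X → ChildrenComparable C n m k μ) :
    IsAdicDoublingOn n X μ := by
  refine ⟨C.toNNReal, Real.toNNReal_pos.2 hC, fun m k hX => ?_⟩
  obtain ⟨V, hV, hb⟩ := h m k hX
  have key : ∀ i ∈ Finset.Icc 1 n, ∀ j ∈ Finset.Icc 1 n,
      μ (adicChild n m k i) / μ (adicChild n m k j) ≤ C.toNNReal := fun i hi j hj => by
    have : ENNReal.ofReal (C * V) / ENNReal.ofReal V = C.toNNReal := by
      rw [← ENNReal.ofReal_div_of_pos hV, mul_div_cancel_right₀ _ hV.ne']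
      rfl
    rw [← this]
    exact ENNReal.div_le_div (hb i hi).2 (hb j hj).1
  refine fun i hi j hj => ⟨?_, key i hi j hj⟩
  have h0 : ∀ i ∈ Finset.Icc 1 n, μ (adicChild n m k i) ≠ 0 := fun i hi =>
    ((ENNReal.ofReal_pos.2 hV).trans_le (hb i hi).1).ne'
  have ht : ∀ i ∈ Finset.Icc 1 n, μ (adicChild n m k i) ≠ ∞ := fun i hi =>
    ((hb i hi).2.trans_lt ENNReal.ofReal_lt_top).ne
  -- The lower bound is the upper bound for the inverse ratio; inverting the quotient needs masses
  -- that are neither `0` nor `∞`.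
  rw [ENNReal.inv_le_iff_inv_le, ENNReal.inv_div (Or.inl (ht j hj)) (Or.inl (h0 j hj))]
  exact key j hj i hi

/-- The central dichotomy. For `X ≤ m` the adic interval lies on one side of `z + 1 / n ^ X`, hence
on one side of `z + lam` up to `δ`. For `m < X` its children are too long to notice the structure at
scale `lam`. -/
theorem IsTwoSidedShell.childrenComparable {c lam δ : ℝ} {w g h : ℝ → ℝ} {R : Set ℝ} {z : ℤ}
    (H : IsTwoSidedShell c (z + lam) lam δ w g h R) (hc : 1 ≤ c) (hlam : 0 < lam) {n : ℕ}
    (hn : 2 ≤ n) {X m k : ℤ} (hX : |lam - 1 / (n : ℝ) ^ X| ≤ δ) (hδ : δ ≤ lam / 2) (hm : 0 ≤ m)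
    (hR : adicInterval n m k ⊆ R) {μ : Measure ℝ}
    (hμ : ∀ s t, Ico s t ⊆ R → μ (Ico s t) = ∫⁻ y in Ico s t, ENNReal.ofReal (w y)) :
    ChildrenComparable (16 * n * c ^ (n + 6) + 68 * c ^ 5) n m k μ := by
  have hn0 : 0 < n := by omega
  have hn1 : (1 : ℝ) ≤ n := by exact_mod_cast hn0
  have hnR : (0 : ℝ) < n := by linarith
  have hsubset : ∀ j ∈ Finset.Icc 1 n, adicChild n m k j ⊆ R := fun j hj =>
    (adicChild_subset hn0 m k hj).trans hR
  rcases le_or_gt X m with hmX | hmX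
  · refine ChildrenComparable.mono (C := 16 * n * c ^ (n + 6))
      (le_add_of_nonneg_right (by positivity)) ?_
    -- The point `z + 1 / n ^ X` is an end point of the level-`m` grid: `0 ≤ m` puts the integer `z`
    -- on the grid, and `X ≤ m` puts `1 / n ^ X` there.
    obtain ⟨t, ht⟩ : ∃ t : ℤ, (z : ℝ) + 1 / (n : ℝ) ^ X = t / (n : ℝ) ^ m := by
      refine ⟨z * (n : ℤ) ^ m.toNat + (n : ℤ) ^ (m - X).toNat, ?_⟩
      push_cast
      rw [← zpow_natCast, ← zpow_natCast, Int.toNat_of_nonneg hm,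
        Int.toNat_of_nonneg (sub_nonneg.2 hmX), zpow_sub₀ hnR.ne']
      field_simp
    have hp : 0 < (n : ℝ) ^ m := by positivity
    have hX' := abs_le.1 hX
    have hJ := adicInterval_eq n m k
    rw [hJ] at hR
    have hℓ : 0 < ((n : ℝ) ^ m)⁻¹ := by positivity
    have main : ∃ V, 0 < V ∧ ∀ u, Ico u (u + ((n : ℝ) ^ m)⁻¹ / n) ⊆ Ico (((k : ℝ) - 1) / (n : ℝ) ^ m)
          (((k : ℝ) - 1) / (n : ℝ) ^ m + ((n : ℝ) ^ m)⁻¹) →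
        ENNReal.ofReal V ≤ ∫⁻ y in Ico u (u + ((n : ℝ) ^ m)⁻¹ / n), ENNReal.ofReal (w y) ∧
        ∫⁻ y in Ico u (u + ((n : ℝ) ^ m)⁻¹ / n), ENNReal.ofReal (w y) ≤
          ENNReal.ofReal (16 * n * c ^ (n + 6) * V) := by
      rcases le_or_gt k t with hkt | hkt
      · refine H.exists_bounds_of_left hc hℓ hn0 hR ?_
        have : (k : ℝ) ≤ t := by exact_mod_cast hkt
        have : (k : ℝ) / (n : ℝ) ^ m ≤ t / (n : ℝ) ^ m := by gcongr
        have : ((k : ℝ) - 1) / (n : ℝ) ^ m + ((n : ℝ) ^ m)⁻¹ = k / (n : ℝ) ^ m := by ring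
        linarith [hX'.1]
      · refine H.exists_bounds_of_right hc hℓ hn0 hR ?_
        have : (t : ℝ) ≤ k - 1 := by
          have : (t : ℝ) + 1 ≤ k := by exact_mod_cast hkt
          linarith
        have : (t : ℝ) / (n : ℝ) ^ m ≤ (k - 1) / (n : ℝ) ^ m := by gcongr
        linarith [hX'.2]
    obtain ⟨V, hV, hmain⟩ := main
    refine ⟨V, hV, fun j hj => ?_⟩
    have h1 := adicChild_subset hn0 m k hj
    have h2 := hsubset j hj
    rw [hJ, adicChild_eq hn0] at h1
    rw [adicChild_eq hn0] at h2 ⊢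
    rw [hμ _ _ h2]
    exact hmain _ h1
  · refine ChildrenComparable.mono (C := 68 * c ^ 5)
      (le_add_of_nonneg_left (by positivity)) ?_
    set ℓ := ((n : ℝ) ^ m)⁻¹ / n with hℓdef
    have hℓ : 0 < ℓ := by positivity
    -- `m + 1 ≤ X` gives `ℓ ≥ 1 / n ^ X ≥ lam - δ ≥ lam / 2`. Then `le_mass` applies with `k = 4`,
    -- and `ℓ + 8 * c * lam ≤ 17 * c * ℓ`.
    have hbig : lam / 2 ≤ ℓ := by
      have h1 : ℓ = 1 / (n : ℝ) ^ (m + 1) := by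
        rw [hℓdef, zpow_add_one₀ hnR.ne']
        field_simp
      have h2 : 1 / (n : ℝ) ^ X ≤ ℓ := by
        rw [h1]
        gcongr
        · omega
      linarith [(abs_le.1 hX).2]
    refine ⟨ℓ / (4 * c ^ 4), by positivity, fun j hj => ?_⟩
    have h2 := hsubset j hj
    rw [adicChild_eq hn0] at h2 ⊢
    rw [hμ _ _ h2]
    refine ⟨H.le_mass hc hℓ h2 (by norm_num; linarith), (H.mass_le hc hlam hℓ.le h2).trans
      (ENNReal.ofReal_le_ofReal ?_)⟩
    have : 68 * c ^ 5 * (ℓ / (4 * c ^ 4)) = 17 * c * ℓ := by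
      field_simp
      ring
    rw [this]
    nlinarith

/-! ### Profiles built by repeated redistribution on dyadic shells -/

/-- The density, as a function of the distance `d` to a point, that arises from the mean density
`p` on distances up to `ℓ` by giving, for `k < N`, the inner and the outer half of the distances up
to `ℓ / 2 ^ k` the weights `c k` and `2 - c k`. -/
noncomputable def shellProfile (ℓ p : ℝ) (c : ℕ → ℝ) (N : ℕ) (d : ℝ) : ℝ :=
  (if d ≤ ℓ then p else 1) * ∏ k ∈ Finset.range N,
    if d ≤ ℓ / 2 ^ k / 2 then c k else if d ≤ ℓ / 2 ^ k then 2 - c k else 1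

/-- The mean of `shellProfile` on distances up to `ℓ / 2 ^ i`. -/
noncomputable def shellMean (p : ℝ) (c : ℕ → ℝ) (N i : ℕ) : ℝ :=
  p * ∏ k ∈ Finset.range (min i N), c k

section shellProfile

variable {ℓ p : ℝ} {c : ℕ → ℝ} {N : ℕ}

theorem shellProfile_far (hℓ : 0 < ℓ) {d : ℝ} (hd : ℓ < d) : shellProfile ℓ p c N d = 1 := by
  have h : ∀ k : ℕ, ℓ / 2 ^ k < d := fun k =>
    (div_le_self hℓ.le (one_le_pow₀ (by norm_num))).trans_lt hd
  rw [shellProfile, if_neg (not_le.2 hd), one_mul]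
  refine Finset.prod_eq_one fun k _ => ?_
  have := h k
  have : 0 < ℓ / 2 ^ k := by positivity
  rw [if_neg (by linarith), if_neg (by linarith)]

theorem shellProfile_core (hℓ : 0 < ℓ) {d : ℝ} (hd : d ≤ ℓ / 2 ^ N) :
    shellProfile ℓ p c N d = shellMean p c N N := by
  have h : ∀ k : ℕ, k ≤ N → d ≤ ℓ / 2 ^ k := fun k hk =>
    hd.trans (by gcongr; norm_num)
  rw [shellProfile, shellMean, if_pos (by simpa using h 0 (by omega)), min_self]
  congr 1
  refine Finset.prod_congr rfl fun k hk => ?_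
  have := h (k + 1) (Finset.mem_range.1 hk)
  rw [pow_succ, ← div_div] at this
  rw [if_pos this]

theorem shellMean_succ_of_lt {i : ℕ} (h : i < N) :
    shellMean p c N (i + 1) = shellMean p c N i * c i := by
  rw [shellMean, shellMean, min_eq_left h, min_eq_left h.le, Finset.prod_range_succ, mul_assoc]

theorem shellMean_of_le {i : ℕ} (h : N ≤ i) : shellMean p c N i = shellMean p c N N := by
  rw [shellMean, shellMean, min_eq_right h, min_self]

/-- Weights `c k` and `2 - c k` preserve mass: the mean up to `ℓ / 2 ^ i` is the average of the mean
of the inner half and the constant value on the outer half. This also covers `N ≤ i`, where the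
means are stationary. -/
theorem shellProfile_shell (hℓ : 0 < ℓ) {d : ℝ} {i : ℕ} (h1 : ℓ / 2 ^ (i + 1) < d)
    (h2 : d ≤ ℓ / 2 ^ i) :
    shellProfile ℓ p c N d = 2 * shellMean p c N i - shellMean p c N (i + 1) := by
  rcases le_or_gt N i with h | h
  · rw [shellProfile_core hℓ (h2.trans (by gcongr; norm_num)), shellMean_of_le h,
      shellMean_of_le (i := i + 1) (by omega)]
    ring
  · have hprod : ∀ M, i < M → (∏ k ∈ Finset.range M,
        if d ≤ ℓ / 2 ^ k / 2 then c k else if d ≤ ℓ / 2 ^ k then 2 - c k else 1) =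
        (∏ k ∈ Finset.range i, c k) * (2 - c i) := by
      intro M hM
      induction M, hM using Nat.le_induction with
      | base =>
        rw [Finset.prod_range_succ]
        congr 1
        · refine Finset.prod_congr rfl fun k hk => if_pos (h2.trans ?_)
          rw [div_div, ← pow_succ]
          have := Finset.mem_range.1 hk
          gcongr
          · norm_num
          · omega
        · rw [pow_succ, ← div_div] at h1
          rw [if_neg (not_le.2 h1), if_pos h2]
      | succ M hM ih =>
        have h3 : ℓ / 2 ^ M < d := lt_of_le_of_lt (by gcongr; norm_num) h1
        have : 0 < ℓ / 2 ^ M := by positivity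
        rw [Finset.prod_range_succ, ih, if_neg (by linarith), if_neg (by linarith), mul_one]
    have h0 : d ≤ ℓ := h2.trans (div_le_self hℓ.le (one_le_pow₀ (by norm_num)))
    rw [shellProfile, if_pos h0, hprod N h, shellMean_succ_of_lt h, shellMean, min_eq_left h.le]
    ring

theorem exists_shell {d : ℝ} (hd : 0 < d) (hdℓ : d ≤ ℓ) :
    ∃ i : ℕ, ℓ / 2 ^ (i + 1) < d ∧ d ≤ ℓ / 2 ^ i := by
  obtain ⟨i, h1, h2⟩ := exists_nat_pow_near ((one_le_div hd).2 hdℓ) (one_lt_two)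
  refine ⟨i, ?_, ?_⟩
  · rw [div_lt_comm₀ (by positivity) hd]
    exact h2
  · rw [le_div_comm₀ hd (by positivity)]
    exact h1

/-- The mean density `p` and the weights `c k`, `2 - c k` all lie in `[a, 2 - a]`. -/
structure IsAdmissible (a p : ℝ) (c : ℕ → ℝ) : Prop where
  pos : 0 < a
  lt_one : a < 1
  le_mean : a ≤ p
  mean_le : p ≤ 2 - a
  le_weight : ∀ k, a ≤ c k
  weight_le : ∀ k, c k ≤ 2 - a

namespace IsAdmissible

variable {a : ℝ}

theorem shellMean_pos (h : IsAdmissible a p c) (i : ℕ) : 0 < shellMean p c N i :=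
  mul_pos (h.pos.trans_le h.le_mean) (Finset.prod_pos fun k _ => h.pos.trans_le (h.le_weight k))

theorem shellMean_succ (h : IsAdmissible a p c) (i : ℕ) :
    a * shellMean p c N i ≤ shellMean p c N (i + 1) ∧
      shellMean p c N (i + 1) ≤ (2 - a) * shellMean p c N i := by
  have hpos := h.shellMean_pos (N := N) i
  have h1 := h.lt_one
  rcases le_or_gt N i with hi | hi
  · rw [shellMean_of_le hi] at hpos ⊢
    rw [shellMean_of_le (i := i + 1) (by omega)]
    constructor <;> nlinarith
  · rw [shellMean_succ_of_lt hi]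
    have := h.le_weight i
    have := h.weight_le i
    constructor <;> nlinarith

theorem profile_shell (h : IsAdmissible a p c) (hℓ : 0 < ℓ) {d : ℝ} {i : ℕ}
    (h1 : ℓ / 2 ^ (i + 1) < d) (h2 : d ≤ ℓ / 2 ^ i) :
    a * shellMean p c N i ≤ shellProfile ℓ p c N d ∧
      shellProfile ℓ p c N d ≤ 2 * shellMean p c N i := by
  rw [shellProfile_shell hℓ h1 h2]
  have := h.shellMean_succ (N := N) i
  have := h.shellMean_pos (N := N) (i + 1)
  constructor <;> linarith

theorem profile_pos (h : IsAdmissible a p c) (d : ℝ) : 0 < shellProfile ℓ p c N d := by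
  refine mul_pos ?_ (Finset.prod_pos fun k _ => ?_)
  · split_ifs
    · exact h.pos.trans_le h.le_mean
    · exact one_pos
  · have := h.pos
    have := h.le_weight k
    have := h.weight_le k
    split_ifs <;> linarith

/-- Downward induction on `i` from the core, where the profile is constant: each step adds one
shell, whose value is `2 * shellMean p c N i - shellMean p c N (i + 1)`. -/
theorem setLIntegral_profile (h : IsAdmissible a p c) (hℓ : 0 < ℓ) (i : ℕ) :
    ∫⁻ t in Ioc 0 (ℓ / 2 ^ i), ENNReal.ofReal (shellProfile ℓ p c N t) =
      ENNReal.ofReal (shellMean p c N i * (ℓ / 2 ^ i)) := by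
  have core : ∀ i, N ≤ i → ∫⁻ t in Ioc 0 (ℓ / 2 ^ i), ENNReal.ofReal (shellProfile ℓ p c N t) =
      ENNReal.ofReal (shellMean p c N i * (ℓ / 2 ^ i)) := fun i hi => by
    have : ∀ t ∈ Ioc 0 (ℓ / 2 ^ i), ENNReal.ofReal (shellProfile ℓ p c N t) =
        ENNReal.ofReal (shellMean p c N N) := fun t ht => by
      rw [shellProfile_core hℓ (ht.2.trans (by gcongr; norm_num))]
    rw [setLIntegral_congr_fun measurableSet_Ioc this, setLIntegral_const, Real.volume_Ioc,
      shellMean_of_le hi, ENNReal.ofReal_mul (h.shellMean_pos N).le, sub_zero]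
  rcases le_or_gt N i with hi | hi
  · exact core i hi
  refine Nat.decreasingInduction' (P := fun i => ∫⁻ t in Ioc 0 (ℓ / 2 ^ i),
    ENNReal.ofReal (shellProfile ℓ p c N t) = ENNReal.ofReal (shellMean p c N i * (ℓ / 2 ^ i)))
    (fun i _ _ ih => ?_) hi.le (core N le_rfl)
  have hle : ℓ / 2 ^ (i + 1) ≤ ℓ / 2 ^ i := by
    gcongr
    · norm_num
    · omega
  have h0 : 0 < ℓ / 2 ^ (i + 1) := by positivity
  have hq : 0 ≤ 2 * shellMean p c N i - shellMean p c N (i + 1) := by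
    have := h.shellMean_succ (N := N) i
    have := h.shellMean_pos (N := N) i
    nlinarith [h.pos]
  have hval : ∀ t ∈ Ioc (ℓ / 2 ^ (i + 1)) (ℓ / 2 ^ i), ENNReal.ofReal (shellProfile ℓ p c N t) =
      ENNReal.ofReal (2 * shellMean p c N i - shellMean p c N (i + 1)) := fun t ht => by
    rw [shellProfile_shell hℓ ht.1 ht.2]
  rw [← Ioc_union_Ioc_eq_Ioc h0.le hle,
    lintegral_union measurableSet_Ioc (Ioc_disjoint_Ioc_of_le le_rfl), ih,
    setLIntegral_congr_fun measurableSet_Ioc hval, setLIntegral_const, Real.volume_Ioc,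
    ← ENNReal.ofReal_mul hq, ← ENNReal.ofReal_add]
  · congr 1
    rw [pow_succ]
    field_simp
    ring
  · exact mul_nonneg (h.shellMean_pos _).le h0.le
  · exact mul_nonneg hq (by linarith)

theorem shellMean_zero_eq : shellMean p c N 0 = p := by simp [shellMean]

/-- Shell values lie between `a` and `2` times the mean of their shell, and consecutive means differ
by a factor in `[a, 2 - a]`. The bound is therefore independent of the number `N` of steps. -/
theorem slowlyVarying (h : IsAdmissible a p c) (hℓ : 0 < ℓ) :
    SlowlyVarying (4 / a ^ 2) (shellProfile ℓ p c N) := by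
  have ha0 := h.pos
  have ha1 := h.lt_one
  have hC : 4 / a ^ 2 = 4 / a / a := by field_simp
  have hC1 : 4 ≤ 4 / a := by rw [le_div_iff₀ ha0]; nlinarith
  have hC2 : 4 / a ≤ 4 / a ^ 2 := by
    rw [hC, le_div_iff₀ ha0]
    nlinarith
  have hC0 : 0 < 4 / a ^ 2 := by positivity
  have hkey : ∀ x y : ℝ, a ^ 2 * x ≤ 4 * y → x ≤ 4 / a ^ 2 * y := fun x y hxy => by
    rw [div_mul_eq_mul_div, le_div_iff₀ (by positivity)]
    linarith
  have hsq : a ^ 2 ≤ a := by nlinarith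
  refine ⟨h.profile_pos, fun d e hd hde hed => ?_, fun d hd => ?_⟩
  · rcases lt_or_ge ℓ d with hdℓ | hdℓ
    · rw [shellProfile_far hℓ hdℓ, shellProfile_far hℓ (hdℓ.trans_le hde)]
      constructor <;> linarith
    obtain ⟨i, hi1, hi2⟩ := exists_shell hd hdℓ
    obtain ⟨hq1, hq2⟩ := h.profile_shell (N := N) hℓ hi1 hi2
    have hP := h.shellMean_pos (N := N) i
    rcases lt_or_ge ℓ e with heℓ | heℓ
    · have hi : i = 0 := by
        by_contra hne
        have : ℓ / 2 ^ i ≤ ℓ / 2 ^ 1 := by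
          gcongr
          · norm_num
          · omega
        linarith
      subst hi
      rw [shellMean_zero_eq] at hq1 hq2
      have := h.le_mean
      have := h.mean_le
      rw [shellProfile_far hℓ heℓ]
      constructor <;> apply hkey <;> nlinarith
    obtain ⟨j, hj1, hj2⟩ := exists_shell (hd.trans_le hde) heℓ
    obtain ⟨hr1, hr2⟩ := h.profile_shell (N := N) hℓ hj1 hj2
    have hQ := h.shellMean_pos (N := N) j
    -- Since `d ≤ e ≤ 2 * d`, the two shells are equal or adjacent.
    have hji : j ≤ i := by
      by_contra! hlt
      have : ℓ / 2 ^ j ≤ ℓ / 2 ^ (i + 1) := by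
        gcongr
        · norm_num
        · omega
      linarith
    have hij : i ≤ j + 1 := by
      by_contra! hlt
      have : ℓ / 2 ^ i ≤ ℓ / 2 ^ (j + 1 + 1) := by
        gcongr
        · norm_num
        · omega
      rw [pow_succ _ (j + 1), ← div_div] at this
      linarith
    have hvd := h.profile_pos (ℓ := ℓ) (N := N) d
    have hve := h.profile_pos (ℓ := ℓ) (N := N) e
    rcases hji.eq_or_lt with rfl | hlt
    · constructor <;> apply hkey <;> nlinarith
    · obtain rfl : i = j + 1 := by omega
      obtain ⟨hm1, hm2⟩ := h.shellMean_succ (N := N) j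
      constructor <;> apply hkey
      · calc a ^ 2 * shellProfile ℓ p c N d ≤ a * (2 * ((2 - a) * shellMean p c N j)) := by
              have : a ^ 2 * shellProfile ℓ p c N d ≤ a * shellProfile ℓ p c N d := by gcongr
              have : a * shellProfile ℓ p c N d ≤ a * (2 * ((2 - a) * shellMean p c N j)) := by
                gcongr
                linarith
              linarith
          _ ≤ 4 * (a * shellMean p c N j) := by
              have : 0 < a * shellMean p c N j := by positivity
              nlinarith
          _ ≤ _ := by linarith
      · calc a ^ 2 * shellProfile ℓ p c N e ≤ a ^ 2 * (2 * shellMean p c N j) := by gcongr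
          _ = 2 * (a * (a * shellMean p c N j)) := by ring
          _ ≤ 2 * (a * shellMean p c N (j + 1)) := by gcongr
          _ ≤ 4 * shellProfile ℓ p c N d := by linarith
  · rcases lt_or_ge ℓ d with hdℓ | hdℓ
    · rw [← Ioc_union_Ioc_eq_Ioc hℓ.le hdℓ.le,
        lintegral_union measurableSet_Ioc (Ioc_disjoint_Ioc_of_le le_rfl)]
      have e1 := h.setLIntegral_profile (N := N) hℓ 0
      rw [pow_zero, div_one, shellMean_zero_eq] at e1
      have e2 : ∀ t ∈ Ioc ℓ d, ENNReal.ofReal (shellProfile ℓ p c N t) = ENNReal.ofReal 1 :=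
        fun t ht => by rw [shellProfile_far hℓ ht.1]
      rw [e1, setLIntegral_congr_fun measurableSet_Ioc e2, setLIntegral_const, Real.volume_Ioc,
        ← ENNReal.ofReal_mul zero_le_one, ← ENNReal.ofReal_add
          (mul_nonneg (ha0.le.trans h.le_mean) hℓ.le) (by linarith), shellProfile_far hℓ hdℓ]
      apply ENNReal.ofReal_le_ofReal
      have := h.mean_le
      nlinarith
    · obtain ⟨i, hi1, hi2⟩ := exists_shell hd hdℓ
      obtain ⟨hq1, hq2⟩ := h.profile_shell (N := N) hℓ hi1 hi2
      have hP := h.shellMean_pos (N := N) i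
      refine (lintegral_mono_set (Ioc_subset_Ioc_right hi2)).trans ?_
      rw [h.setLIntegral_profile hℓ]
      apply ENNReal.ofReal_le_ofReal
      have h2 : ℓ / 2 ^ i ≤ 2 * d := by
        rw [pow_succ, ← div_div] at hi1
        linarith
      calc shellMean p c N i * (ℓ / 2 ^ i) ≤ shellMean p c N i * (2 * d) := by gcongr
        _ ≤ (shellProfile ℓ p c N d / a) * (2 * d) := by
            gcongr
            rw [le_div_iff₀ ha0]
            linarith
        _ = 2 / a * d * shellProfile ℓ p c N d := by ring
        _ ≤ 4 / a ^ 2 * d * shellProfile ℓ p c N d := by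
            have := h.profile_pos (ℓ := ℓ) (N := N) d
            have : 2 / a ≤ 4 / a := by gcongr; norm_num
            gcongr
            linarith

end IsAdmissible

end shellProfile

/-! ### The Anderson–Hu densities as shell profiles -/

theorem splitWeight_of_lt {p q Z ℓ y : ℝ} (hℓ : 0 < ℓ) (hy : y < Z) :
    splitWeight p q Z (Z + ℓ) y = 1 := by
  rw [splitWeight, if_neg (fun h => by linarith [h.1]), if_neg (fun h => by linarith [h.1])]

theorem splitWeight_of_le {p q Z ℓ y : ℝ} (hℓ : 0 < ℓ) (hy : Z ≤ y) :
    splitWeight p q (Z - ℓ) Z y = 1 := by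
  rw [splitWeight, if_neg (fun h => by linarith [h.2]), if_neg (fun h => by linarith [h.2])]

/-- The half-open intervals exclude their right end points, while shells include their outer radius;
on the right of `Z` these conventions clash at two points. On the left they agree. -/
theorem splitWeight_right {p q Z ℓ y : ℝ} (hy : Z ≤ y) (h1 : y - Z ≠ ℓ)
    (h2 : y - Z ≠ ℓ / 2) :
    splitWeight p q Z (Z + ℓ) y = if y - Z ≤ ℓ / 2 then p else if y - Z ≤ ℓ then q else 1 := by
  rw [splitWeight]
  rcases lt_or_gt_of_ne h2 with h | h
  · rw [if_pos ⟨hy, by linarith⟩, if_pos h.le]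
  · rw [if_neg (fun hh => by linarith [hh.2]), if_neg (not_le.2 h)]
    rcases lt_or_gt_of_ne h1 with h' | h'
    · rw [if_pos ⟨by linarith, by linarith⟩, if_pos h'.le]
    · rw [if_neg (fun hh => by linarith [hh.2]), if_neg (not_le.2 h')]

theorem splitWeight_left {p q Z ℓ y : ℝ} (hℓ : 0 < ℓ) (hy : y < Z) :
    splitWeight p q (Z - ℓ) Z y = if Z - y ≤ ℓ / 2 then q else if Z - y ≤ ℓ then p else 1 := by
  rw [splitWeight]
  rcases le_or_gt (Z - y) (ℓ / 2) with h | h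
  · rw [if_neg (fun hh => by linarith [hh.2]), if_pos ⟨by linarith, by linarith⟩, if_pos h]
  · rw [if_neg (not_le.2 h)]
    rcases le_or_gt (Z - y) ℓ with h' | h'
    · rw [if_pos ⟨by linarith, by linarith⟩, if_pos h']
    · rw [if_neg (fun hh => by linarith [hh.1]), if_neg (fun hh => by linarith [hh.1]),
        if_neg (not_le.2 h')]

/-- The weight `p` in the first `u` steps and `q` afterwards. -/
noncomputable def twoPhase (p q : ℝ) (u k : ℕ) : ℝ := if k < u then p else q

theorem prod_twoPhase (p q : ℝ) (u v : ℕ) :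
    ∏ k ∈ Finset.range (u + v), twoPhase p q u k = p ^ u * q ^ v := by
  rw [Finset.prod_range_add]
  congr 1
  · refine (Finset.prod_congr rfl (g := fun _ => p)
      fun k hk => if_pos (Finset.mem_range.1 hk)).trans ?_
    simp
  · simp [twoPhase]

theorem isAdmissible_twoPhase {a p q r : ℝ} (ha0 : 0 < a) (ha1 : a < 1)
    (hr : a ≤ r ∧ r ≤ 2 - a) (hp : a ≤ p ∧ p ≤ 2 - a) (hq : a ≤ q ∧ q ≤ 2 - a) (u : ℕ) :
    IsAdmissible a r (twoPhase p q u) := by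
  refine ⟨ha0, ha1, hr.1, hr.2, fun k => ?_, fun k => ?_⟩ <;> unfold twoPhase <;> split_ifs
  exacts [hp.1, hq.1, hp.2, hq.2]

theorem phaseWeight_of_lt {a Z ℓ y : ℝ} {α k : ℕ} (hℓ : 0 < ℓ) (hy : y < Z) :
    phaseWeight a α k Z (Z + ℓ) y = 1 := by
  rw [phaseWeight, splitWeight_of_lt hℓ hy, splitWeight_of_lt hℓ hy, ite_self]

theorem phaseWeight_of_le {a Z ℓ y : ℝ} {α k : ℕ} (hℓ : 0 < ℓ) (hy : Z ≤ y) :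
    phaseWeight a α k (Z - ℓ) Z y = 1 := by
  rw [phaseWeight, splitWeight_of_le hℓ hy, splitWeight_of_le hℓ hy, ite_self]

/-- On the right the inner half is the left half, so it receives `b` in the first phase and `a` in
the second; on the left the roles are swapped. The steps are renumbered from `0`, so that the first
phase keeps `α - s` of them. -/
theorem phaseWeight_right {a Z ℓ y : ℝ} {α s k : ℕ} (hy : Z ≤ y) (h1 : y - Z ≠ ℓ)
    (h2 : y - Z ≠ ℓ / 2) :
    phaseWeight a α (s + k) Z (Z + ℓ) y =
      if y - Z ≤ ℓ / 2 then twoPhase (2 - a) a (α - s) k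
      else if y - Z ≤ ℓ then 2 - twoPhase (2 - a) a (α - s) k else 1 := by
  rw [phaseWeight, splitWeight_right hy h1 h2, splitWeight_right hy h1 h2, twoPhase]
  by_cases h : s + k < α
  · have h' : k < α - s := by omega
    simp only [if_pos h, if_pos h', sub_sub_cancel]
  · have h' : ¬ k < α - s := by omega
    simp only [if_neg h, if_neg h']

theorem phaseWeight_left {a Z ℓ y : ℝ} {α s k : ℕ} (hℓ : 0 < ℓ) (hy : y < Z) :
    phaseWeight a α (s + k) (Z - ℓ) Z y =
      if Z - y ≤ ℓ / 2 then twoPhase a (2 - a) (α - s) k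
      else if Z - y ≤ ℓ then 2 - twoPhase a (2 - a) (α - s) k else 1 := by
  rw [phaseWeight, splitWeight_left hℓ hy, splitWeight_left hℓ hy, twoPhase]
  by_cases h : s + k < α
  · have h' : k < α - s := by omega
    simp only [if_pos h, if_pos h']
  · have h' : ¬ k < α - s := by omega
    simp only [if_neg h, if_neg h', sub_sub_cancel]

/-- The profile to the right of the distinguished point, with mean density `p` up to `lam`. -/
noncomputable def rightProfile (a p lam : ℝ) (α : ℕ) : ℝ → ℝ :=
  shellProfile lam p (twoPhase (2 - a) a (α - 1)) (2 * α - 1)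

/-- The profile to the left of the distinguished point when the first `s - 1` halves are left
unchanged. -/
noncomputable def leftProfile (a ℓ : ℝ) (s α : ℕ) : ℝ → ℝ :=
  shellProfile ℓ a (twoPhase a (2 - a) (α - s)) (2 * α - s)

theorem two_mul_div_pow_succ (lam : ℝ) (k : ℕ) : 2 * lam / 2 ^ (1 + k) = lam / 2 ^ k := by
  rw [pow_add, pow_one, mul_div_mul_left _ _ two_ne_zero]

theorem prod_phaseWeight_right {a Z lam y : ℝ} {α : ℕ} (hy : Z ≤ y)
    (hgen : ∀ k : ℕ, y - Z ≠ lam / 2 ^ k) :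
    ∏ k ∈ Finset.Ico 1 (2 * α), phaseWeight a α k Z (Z + 2 * lam / 2 ^ k) y =
      ∏ k ∈ Finset.range (2 * α - 1), if y - Z ≤ lam / 2 ^ k / 2 then
        twoPhase (2 - a) a (α - 1) k
        else if y - Z ≤ lam / 2 ^ k then 2 - twoPhase (2 - a) a (α - 1) k else 1 := by
  rw [Finset.prod_Ico_eq_prod_range]
  refine Finset.prod_congr rfl fun k _ => ?_
  rw [two_mul_div_pow_succ]
  refine phaseWeight_right hy (hgen k) ?_
  rw [div_div, ← pow_succ]
  exact hgen (k + 1)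

theorem prod_phaseWeight_left {a Z lam y : ℝ} {α s : ℕ} (hlam : 0 < lam) (hy : y < Z) :
    ∏ k ∈ Finset.Ico s (2 * α), phaseWeight a α k (Z - 2 * lam / 2 ^ k) Z y =
      ∏ k ∈ Finset.range (2 * α - s), if Z - y ≤ 2 * lam / 2 ^ s / 2 ^ k / 2 then
        twoPhase a (2 - a) (α - s) k
        else if Z - y ≤ 2 * lam / 2 ^ s / 2 ^ k then 2 - twoPhase a (2 - a) (α - s) k else 1 := by
  rw [Finset.prod_Ico_eq_prod_range]
  refine Finset.prod_congr rfl fun k _ => ?_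
  rw [pow_add, ← div_div]
  exact phaseWeight_left (by positivity) hy

theorem blockWeight_right {a l y : ℝ} {α x : ℕ} (hα : α ≠ 0) (hy : l + 1 / 2 ^ x ≤ y)
    (hgen : ∀ k : ℕ, y - (l + 1 / 2 ^ x) ≠ 1 / 2 ^ x / 2 ^ k) :
    blockWeight a l α x y = rightProfile a (2 - a) (1 / 2 ^ x) α (y - (l + 1 / 2 ^ x)) := by
  rw [blockWeight, if_neg hα]
  have hlam : (0 : ℝ) < 1 / 2 ^ x := by positivity
  have e : ((2 : ℝ) / 2 ^ x) = 2 * (1 / 2 ^ x) := by ring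
  rw [e]
  generalize (1 : ℝ) / 2 ^ x = lam at *
  have h0 := hgen 0
  rw [pow_zero, div_one] at h0
  rw [prod_phaseWeight_right hy hgen, Finset.prod_eq_one fun k _ => phaseWeight_of_le
    (by positivity) hy, mul_one, rightProfile, shellProfile, splitWeight,
    if_neg (fun h => by linarith [h.2])]
  congr 1
  rcases lt_or_gt_of_ne h0 with h | h
  · rw [if_pos ⟨by linarith, by linarith⟩, if_pos h.le]
  · rw [if_neg (fun hh => by linarith [hh.2]), if_neg (not_le.2 h)]

theorem blockWeight_left {a l y : ℝ} {α x : ℕ} (hα : α ≠ 0) (hy : y < l + 1 / 2 ^ x) :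
    blockWeight a l α x y = leftProfile a (1 / 2 ^ x) 1 α (l + 1 / 2 ^ x - y) := by
  rw [blockWeight, if_neg hα]
  have hlam : (0 : ℝ) < 1 / 2 ^ x := by positivity
  have e : ((2 : ℝ) / 2 ^ x) = 2 * (1 / 2 ^ x) := by ring
  rw [e]
  generalize (1 : ℝ) / 2 ^ x = lam at *
  rw [prod_phaseWeight_left hlam hy, Finset.prod_eq_one (s := Finset.Ico 1 (2 * α))
    fun k _ => phaseWeight_of_lt (by positivity) hy, mul_one, leftProfile, shellProfile,
    splitWeight, pow_one, mul_div_cancel_left₀ _ two_ne_zero]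
  congr 1
  rcases le_or_gt (l + lam - y) lam with h | h
  · rw [if_pos ⟨by linarith, by linarith⟩, if_pos h]
  · rw [if_neg (fun hh => by linarith [hh.1]), if_neg (fun hh => by linarith [hh.1]),
      if_neg (not_le.2 h)]

theorem compactBlockWeight_right {a y : ℝ} {α x : ℕ} (hα : α ≠ 0) (hy : 1 / 2 ^ x ≤ y)
    (hgen : ∀ k : ℕ, y - 1 / 2 ^ x ≠ 1 / 2 ^ x / 2 ^ k) :
    compactBlockWeight a α x y = rightProfile a ((3 - a) / 2) (1 / 2 ^ x) α (y - 1 / 2 ^ x) := by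
  rw [compactBlockWeight, if_neg hα, compactFirstWeight]
  have hlam : (0 : ℝ) < 1 / 2 ^ x := by positivity
  have e : ((2 : ℝ) / 2 ^ x) = 2 * (1 / 2 ^ x) := by ring
  rw [e]
  generalize (1 : ℝ) / 2 ^ x = lam at *
  have h0 := hgen 0
  rw [pow_zero, div_one] at h0
  rw [prod_phaseWeight_right hy hgen, Finset.prod_eq_one fun k _ => phaseWeight_of_le
    (by positivity) hy, mul_one, rightProfile, shellProfile, if_neg (fun h => by linarith [h.2])]
  congr 1
  rcases lt_or_gt_of_ne h0 with h | h
  · rw [if_pos ⟨by linarith, by linarith⟩, if_pos h.le]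
  · rw [if_neg (fun hh => by linarith [hh.2]), if_neg (not_le.2 h)]

theorem compactBlockWeight_left {a y : ℝ} {α x : ℕ} (hα : α ≠ 0) (hy : y < 1 / 2 ^ x) :
    compactBlockWeight a α x y = leftProfile a (1 / 2 ^ x / 2) 2 α (1 / 2 ^ x - y) := by
  rw [compactBlockWeight, if_neg hα, compactFirstWeight]
  have hlam : (0 : ℝ) < 1 / 2 ^ x := by positivity
  have e : ((2 : ℝ) / 2 ^ x) = 2 * (1 / 2 ^ x) := by ring
  rw [e]
  generalize (1 : ℝ) / 2 ^ x = lam at *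
  rw [prod_phaseWeight_left hlam hy, Finset.prod_eq_one (s := Finset.Ico 1 (2 * α))
    fun k _ => phaseWeight_of_lt (by positivity) hy, mul_one, leftProfile, shellProfile,
    show 2 * lam / 2 ^ 2 = lam / 2 by ring]
  congr 1
  rcases le_or_gt (lam - y) (lam / 2) with h | h
  · rw [if_pos ⟨by linarith, by linarith⟩, if_pos h]
  · rw [if_neg (fun hh => by linarith [hh.1]), if_neg (fun hh => by linarith [hh.1]),
      if_neg (not_le.2 h)]

theorem ae_sub_ne_div_pow (Z lam : ℝ) : ∀ᵐ y : ℝ, ∀ k : ℕ, y - Z ≠ lam / 2 ^ k := by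
  filter_upwards [(countable_range fun k : ℕ => Z + lam / 2 ^ k).ae_notMem volume] with y hy k hk
  exact hy ⟨k, by simp only [← hk, add_sub_cancel]⟩

section profiles

variable {a p lam : ℝ} {α s : ℕ}

theorem rightProfile_far (hlam : 0 < lam) {d : ℝ} (hd : lam < d) : rightProfile a p lam α d = 1 :=
  shellProfile_far hlam hd

theorem leftProfile_far (hlam : 0 < lam) {d : ℝ} (hd : lam < d) : leftProfile a lam s α d = 1 :=
  shellProfile_far hlam hd

theorem isAdmissible_right (ha0 : 0 < a) (ha1 : a < 1) (hp : a ≤ p ∧ p ≤ 2 - a) (u : ℕ) :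
    IsAdmissible a p (twoPhase (2 - a) a u) :=
  isAdmissible_twoPhase ha0 ha1 hp ⟨by linarith, le_rfl⟩ ⟨le_rfl, by linarith⟩ u

theorem isAdmissible_left (ha0 : 0 < a) (ha1 : a < 1) (u : ℕ) :
    IsAdmissible a a (twoPhase a (2 - a) u) :=
  isAdmissible_twoPhase ha0 ha1 ⟨le_rfl, by linarith⟩ ⟨le_rfl, by linarith⟩
    ⟨by linarith, le_rfl⟩ u

theorem slowlyVarying_right (ha0 : 0 < a) (ha1 : a < 1) (hp : a ≤ p ∧ p ≤ 2 - a)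
    (hlam : 0 < lam) : SlowlyVarying (4 / a ^ 2) (rightProfile a p lam α) :=
  (isAdmissible_right ha0 ha1 hp _).slowlyVarying hlam

theorem slowlyVarying_left (ha0 : 0 < a) (ha1 : a < 1) (hlam : 0 < lam) :
    SlowlyVarying (4 / a ^ 2) (leftProfile a lam s α) :=
  (isAdmissible_left ha0 ha1 _).slowlyVarying hlam

theorem rightProfile_core (hα : 1 ≤ α) (hlam : 0 < lam) {d : ℝ} (hd : d ≤ lam / 2 ^ (2 * α - 1)) :
    rightProfile a p lam α d = p * ((2 - a) ^ (α - 1) * a ^ α) := by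
  rw [rightProfile, shellProfile_core hlam hd, shellMean, min_self,
    show 2 * α - 1 = (α - 1) + α by omega, prod_twoPhase]

theorem leftProfile_core (hα : s ≤ α) (hlam : 0 < lam) {d : ℝ} (hd : d ≤ lam / 2 ^ (2 * α - s)) :
    leftProfile a lam s α d = a * (a ^ (α - s) * (2 - a) ^ α) := by
  rw [leftProfile, shellProfile_core hlam hd, shellMean, min_self,
    show 2 * α - s = (α - s) + α by omega, prod_twoPhase]

/-- The degenerate compactified block `α = 1`: no redistribution remains on the left, since `2 * α -
2 = 0`. -/
theorem leftProfile_core_one (hlam : 0 < lam) {d : ℝ} (hd : d ≤ lam) :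
    leftProfile a lam 2 1 d = a := by
  rw [leftProfile, shellProfile_core hlam (by simpa using hd), shellMean]
  simp

theorem mass_rightProfile (ha0 : 0 < a) (ha1 : a < 1) (hp : a ≤ p ∧ p ≤ 2 - a)
    (hlam : 0 < lam) :
    ∫⁻ t in Ioc 0 lam, ENNReal.ofReal (rightProfile a p lam α t) = ENNReal.ofReal (p * lam) := by
  have := (isAdmissible_right ha0 ha1 hp (α - 1)).setLIntegral_profile (N := 2 * α - 1) hlam 0
  simpa [IsAdmissible.shellMean_zero_eq, rightProfile, leftProfile] using this

theorem mass_leftProfile (ha0 : 0 < a) (ha1 : a < 1) (hlam : 0 < lam) :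
    ∫⁻ t in Ioc 0 lam, ENNReal.ofReal (leftProfile a lam s α t) = ENNReal.ofReal (a * lam) := by
  have := (isAdmissible_left ha0 ha1 (α - s)).setLIntegral_profile (N := 2 * α - s) hlam 0
  simpa [IsAdmissible.shellMean_zero_eq, rightProfile, leftProfile] using this

/-- At radius `lam / 2 ^ α` one step of the second phase has already acted, whence the single factor
`a`, harmless for the growth in `α`. -/
theorem mass_rightProfile_inner (ha0 : 0 < a) (ha1 : a < 1) (hp : a ≤ p ∧ p ≤ 2 - a)
    (hlam : 0 < lam) (hα : 1 ≤ α) :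
    ∫⁻ t in Ioc 0 (lam / 2 ^ α), ENNReal.ofReal (rightProfile a p lam α t) =
      ENNReal.ofReal (p * ((2 - a) ^ (α - 1) * a) * (lam / 2 ^ α)) := by
  rw [rightProfile, (isAdmissible_right ha0 ha1 hp (α - 1)).setLIntegral_profile hlam, shellMean,
    min_eq_left (by omega)]
  have := prod_twoPhase (2 - a) a (α - 1) 1
  rw [Nat.sub_add_cancel hα, pow_one] at this
  rw [this]

theorem mass_leftProfile_inner (ha0 : 0 < a) (ha1 : a < 1) (hlam : 0 < lam) (hs : s ≤ α) :
    ∫⁻ t in Ioc 0 (lam / 2 ^ (α - s)), ENNReal.ofReal (leftProfile a lam s α t) =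
      ENNReal.ofReal (a ^ (α - s + 1) * (lam / 2 ^ (α - s))) := by
  rw [leftProfile, (isAdmissible_left ha0 ha1 (α - s)).setLIntegral_profile hlam, shellMean,
    min_eq_left (by omega)]
  have := prod_twoPhase a (2 - a) (α - s) 0
  rw [add_zero, pow_zero, mul_one] at this
  rw [this, pow_succ']

end profiles

/-- Near `Z` each side has received `α` weights `a` and `α` weights `b`, so the two core densities
coincide. -/
theorem isTwoSidedShell_block {a : ℝ} (ha0 : 0 < a) (ha1 : a < 1) {α : ℕ} (hα : 1 ≤ α) (x : ℕ)
    (l : ℝ) :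
    IsTwoSidedShell (4 / a ^ 2) (l + 1 / 2 ^ x) (1 / 2 ^ x) (1 / 2 ^ x / 2 ^ (2 * α))
      (blockWeight a l α x) (rightProfile a (2 - a) (1 / 2 ^ x) α)
      (leftProfile a (1 / 2 ^ x) 1 α) univ := by
  have hlam : (0 : ℝ) < 1 / 2 ^ x := by positivity
  refine ⟨slowlyVarying_right ha0 ha1 ⟨by linarith, le_rfl⟩ hlam, slowlyVarying_left ha0 ha1 hlam,
    fun _ => rightProfile_far hlam, fun _ => leftProfile_far hlam, ?_, ?_, fun d hd => ?_⟩
  · filter_upwards [ae_sub_ne_div_pow (l + 1 / 2 ^ x) (1 / 2 ^ x)] with y hy _ hZ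
    exact blockWeight_right (by omega) hZ hy
  · exact Filter.Eventually.of_forall fun y _ hZ => blockWeight_left (by omega) hZ
  · have hd' : d ≤ 1 / 2 ^ x / 2 ^ (2 * α - 1) := hd.trans (by gcongr; norm_num; omega)
    rw [rightProfile_core hα hlam hd', leftProfile_core hα hlam hd']
    obtain ⟨β, rfl⟩ : ∃ β, α = β + 1 := ⟨α - 1, by omega⟩
    have e : (2 - a) * ((2 - a) ^ (β + 1 - 1) * a ^ (β + 1)) =
        a * (a ^ (β + 1 - 1) * (2 - a) ^ (β + 1)) := by
      simp only [Nat.add_sub_cancel]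
      ring
    have hpos : 0 < a * (a ^ (β + 1 - 1) * (2 - a) ^ (β + 1)) := by
      have : 0 < 2 - a := by linarith
      positivity
    have hc : 1 ≤ 4 / a ^ 2 := by
      rw [le_div_iff₀ (by positivity)]
      nlinarith
    rw [e]
    constructor <;> nlinarith

/-- The altered first step leaves the core densities unequal. For `α ≥ 2` they are `(3 - a) / 2 * a`
and `2 - a` times the common factor `(a * b) ^ (α - 1)`; `α = 1` is separate because truncated
subtraction changes the left profile. -/
theorem isTwoSidedShell_compactBlock {a : ℝ} (ha0 : 0 < a) (ha1 : a < 1) {α : ℕ} (hα : 1 ≤ α)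
    (x : ℕ) :
    IsTwoSidedShell (4 / a ^ 2) (1 / 2 ^ x) (1 / 2 ^ x) (1 / 2 ^ x / 2 ^ (2 * α))
      (compactBlockWeight a α x) (rightProfile a ((3 - a) / 2) (1 / 2 ^ x) α)
      (leftProfile a (1 / 2 ^ x / 2) 2 α) univ := by
  have hlam : (0 : ℝ) < 1 / 2 ^ x := by positivity
  refine ⟨slowlyVarying_right ha0 ha1 ⟨by linarith, by linarith⟩ hlam,
    slowlyVarying_left ha0 ha1 (by positivity), fun _ => rightProfile_far hlam,
    fun d hd => leftProfile_far (by positivity) (by linarith), ?_, ?_, fun d hd => ?_⟩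
  · filter_upwards [ae_sub_ne_div_pow (1 / 2 ^ x) (1 / 2 ^ x)] with y hy _ hZ
    exact compactBlockWeight_right (by omega) hZ hy
  · exact Filter.Eventually.of_forall fun y _ hZ => compactBlockWeight_left (by omega) hZ
  · have hd' : d ≤ 1 / 2 ^ x / 2 ^ (2 * α - 1) := hd.trans (by gcongr; norm_num; omega)
    have hkey : ∀ x y : ℝ, x * a ^ 2 ≤ 4 * y → x ≤ 4 / a ^ 2 * y := fun x y hxy => by
      rwa [div_mul_eq_mul_div, le_div_iff₀ (by positivity)]
    rw [rightProfile_core hα hlam hd']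
    have hsq : a ^ 2 ≤ 1 := by nlinarith
    rcases hα.eq_or_lt with rfl | hα2
    · rw [leftProfile_core_one (by positivity) (hd'.trans (by norm_num))]
      simp only [le_refl, tsub_eq_zero_of_le, pow_zero, one_mul, pow_one]
      have := mul_le_mul_of_nonneg_left hsq ha0.le
      have : 0 < a * a ^ 2 := by positivity
      constructor <;> apply hkey <;> nlinarith
    · rw [leftProfile_core hα2 (by positivity) (hd.trans (by
        rw [div_div _ 2, ← pow_succ']
        gcongr
        · norm_num
        · omega))]
      obtain ⟨β, rfl⟩ : ∃ β, α = β + 2 := ⟨α - 2, by omega⟩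
      simp only [show β + 2 - 1 = β + 1 by omega, show β + 2 - 2 = β by omega]
      have hb : 0 < 2 - a := by linarith
      set P := a ^ (β + 1) * (2 - a) ^ (β + 1) with hP
      have hP0 : 0 < P := by positivity
      have e1 : (3 - a) / 2 * ((2 - a) ^ (β + 1) * a ^ (β + 2)) = (3 - a) / 2 * a * P := by
        rw [hP]; ring
      have e2 : a * (a ^ β * (2 - a) ^ (β + 2)) = (2 - a) * P := by
        rw [hP]; ring
      rw [e1, e2]
      constructor <;> apply hkey
      · have : (3 - a) / 2 * a * a ^ 2 ≤ 4 * (2 - a) := by nlinarith [mul_pos ha0 hb]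
        nlinarith
      · have : (2 - a) * a ^ 2 ≤ 4 * ((3 - a) / 2 * a) := by nlinarith [mul_pos ha0 hb]
        nlinarith

/-! ### Simultaneous approximation and sequences of good scales -/

/-- Simultaneous recurrence: some large multiple of a finite family of reals is close to
integers. -/
theorem exists_nat_mul_sub_round_lt {ι : Type*} [Fintype ι] (θ : ι → ℝ) {ε : ℝ} (hε : 0 < ε)
    (M : ℕ) : ∃ x : ℕ, M ≤ x ∧ ∀ i, |x * θ i - round (x * θ i)| < ε := by
  have : Fact ((0 : ℝ) < 1) := ⟨one_pos⟩
  -- On the compact torus the multiples of `θ` have a convergent, hence Cauchy, subsequence; the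
  -- difference of two of its indices is a recurrence time, and indices far apart make it at least
  -- `M`.
  obtain ⟨_, φ, hφ, hlim⟩ :=
    CompactSpace.tendsto_subseq fun k : ℕ => fun i => (((k * θ i : ℝ) : UnitAddCircle))
  obtain ⟨N, hN⟩ := Metric.cauchySeq_iff.1 hlim.cauchySeq ε hε
  have hle : φ N + M ≤ φ (N + M) := by
    induction M with
    | zero => rfl
    | succ M ih =>
      have := hφ (show N + M < N + (M + 1) by omega)
      omega
  refine ⟨φ (N + M) - φ N, by omega, fun i => ?_⟩
  have h1 := (dist_pi_lt_iff hε).1 (hN (N + M) (by omega) N le_rfl) i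
  rw [dist_eq_norm] at h1
  simp only [Function.comp_apply] at h1
  rw [← AddCircle.coe_sub, UnitAddCircle.norm_eq] at h1
  rw [Nat.cast_sub (by omega), sub_mul]
  exact h1

/-- With `t = x * logb n 2 - round (x * logb n 2)` one has `2 ^ x / n ^ round (x * logb n 2) = n ^
t`, which is close to `1` when `t` is close to `0`. Recurrence makes all these `t` small together.
-/
theorem exists_scale (S : Finset ℕ) {η : ℝ} (hη : 0 < η) (M : ℕ) :
    ∃ x : ℕ, M ≤ x ∧ ∀ n ∈ S, 2 ≤ n →
      |1 / (2 : ℝ) ^ x - 1 / (n : ℝ) ^ (round ((x : ℝ) * Real.logb n 2))| < η / (2 : ℝ) ^ x := by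
  have hev : ∀ᶠ t in nhds (0 : ℝ), ∀ n ∈ S, 2 ≤ n → |1 - (n : ℝ) ^ t| < η := by
    rw [Filter.eventually_all_finset]
    intro n _
    by_cases hn : 2 ≤ n
    · have hn0 : (n : ℝ) ≠ 0 := by positivity
      have hcont : ContinuousAt (fun t : ℝ => |1 - (n : ℝ) ^ t|) 0 :=
        (continuousAt_const.sub (Real.continuousAt_const_rpow hn0)).abs
      have : Filter.Tendsto (fun t : ℝ => |1 - (n : ℝ) ^ t|) (nhds 0) (nhds 0) := by
        simpa [ContinuousAt] using hcont
      filter_upwards [this.eventually (gt_mem_nhds hη)] with t ht _ using ht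
    · exact Filter.Eventually.of_forall fun t h => absurd h hn
  obtain ⟨ε, hε, hball⟩ := Metric.eventually_nhds_iff.1 hev
  obtain ⟨x, hx, hx'⟩ := exists_nat_mul_sub_round_lt (fun n : S => Real.logb (n : ℕ) 2) hε M
  refine ⟨x, hx, fun n hn h2 => ?_⟩
  have hn0 : (0 : ℝ) < n := by positivity
  have hn1 : (n : ℝ) ≠ 1 := by
    have : (2 : ℝ) ≤ n := by exact_mod_cast h2
    linarith
  have h := hball (y := x * Real.logb n 2 - round (x * Real.logb n 2))
    (by rw [Real.dist_eq, sub_zero]; exact hx' ⟨n, hn⟩) n hn h2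
  rw [Real.rpow_sub hn0, Real.rpow_intCast, mul_comm (x : ℝ), Real.rpow_mul hn0.le,
    Real.rpow_logb hn0 hn1 two_pos, Real.rpow_natCast, mul_comm _ (x : ℝ)] at h
  have h2x : (0 : ℝ) < 2 ^ x := by positivity
  have hsplit : 1 / (2 : ℝ) ^ x - 1 / (n : ℝ) ^ (round ((x : ℝ) * Real.logb n 2)) =
      (1 - 2 ^ x / (n : ℝ) ^ (round ((x : ℝ) * Real.logb n 2))) / 2 ^ x := by
    field_simp
  rw [hsplit, abs_div, abs_of_pos h2x]
  gcongr

/-- Rapidly increasing scales that approximate well for every `n ≥ 2` in `S`, including the powers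
of `2`. -/
structure IsGoodSequence (S : Finset ℕ) (x : ℕ → ℕ) : Prop where
  one_le : ∀ α, 1 ≤ α → 1 ≤ x α
  approx : ∀ α, 1 ≤ α → ∀ n ∈ S, 2 ≤ n →
    |1 / (2 : ℝ) ^ x α - 1 / (n : ℝ) ^ (round ((x α : ℝ) * Real.logb n 2))|
      < ((2 : ℝ) ^ (100 * α))⁻¹ / (2 : ℝ) ^ x α
  gap : ∀ α, 1 ≤ α → x α + 4 ≤ x (α + 1)

theorem exists_isGoodSequence (S : Finset ℕ) (M : ℕ) :
    ∃ x : ℕ → ℕ, IsGoodSequence S x ∧ M ≤ x 1 := by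
  choose f hf1 hf2 using fun α M : ℕ =>
    exists_scale S (η := ((2 : ℝ) ^ (100 * α))⁻¹) (by positivity) M
  -- The value `x 0 = M` only seeds the recursion; it makes the first genuine scale `x 1` as large
  -- as desired.
  let x : ℕ → ℕ := fun α => Nat.rec M (fun β y => f (β + 1) (y + 4)) α
  have hx : ∀ β, x (β + 1) = f (β + 1) (x β + 4) := fun _ => rfl
  have hgap : ∀ β, x β + 4 ≤ x (β + 1) := fun β => (hf1 _ _).trans_eq (hx β).symm
  refine ⟨x, ⟨fun α hα => ?_, fun α hα => ?_, fun α _ => hgap α⟩, ?_⟩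
  · obtain ⟨β, rfl⟩ : ∃ β, α = β + 1 := ⟨α - 1, by omega⟩
    have := hgap β
    omega
  · obtain ⟨β, rfl⟩ : ∃ β, α = β + 1 := ⟨α - 1, by omega⟩
    rw [hx]
    exact hf2 _ _
  · have h1 : x 0 + 4 ≤ x 1 := hgap 0
    have h0 : x 0 = M := rfl
    omega

namespace IsGoodSequence

variable {S : Finset ℕ} {x : ℕ → ℕ}

theorem isGoodScale (h : IsGoodSequence S x) (hS : ∀ n ∈ S, 0 < n) {α : ℕ} (hα : 1 ≤ α) :
    IsGoodScale S α (x α) := by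
  refine ⟨h.one_le α hα, fun n hn h2 => h.approx α hα n hn ?_⟩
  have := hS n hn
  by_contra hlt
  exact h2 ⟨0, by omega⟩

theorem abs_sub_le (h : IsGoodSequence S x) {α : ℕ} (hα : 1 ≤ α) {n : ℕ} (hn : n ∈ S)
    (h2 : 2 ≤ n) :
    |1 / (2 : ℝ) ^ x α - 1 / (n : ℝ) ^ (round ((x α : ℝ) * Real.logb n 2))| ≤
      1 / 2 ^ x α / 2 ^ (2 * α) := by
  refine (h.approx α hα n hn h2).le.trans ?_
  rw [div_right_comm, ← one_div]
  gcongr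
  · norm_num
  · omega

theorem half_le (h : IsGoodSequence S x) {α : ℕ} (hα : 1 ≤ α) : 1 / (2 : ℝ) ^ x α ≤ 1 / 2 := by
  have := h.one_le α hα
  calc 1 / (2 : ℝ) ^ x α ≤ 1 / 2 ^ 1 := by gcongr; norm_num
    _ = 1 / 2 := by norm_num

end IsGoodSequence

theorem div_two_pow_le_half {lam : ℝ} (hlam : 0 < lam) {α : ℕ} (hα : 1 ≤ α) :
    lam / 2 ^ (2 * α) ≤ lam / 2 := by
  calc lam / 2 ^ (2 * α) ≤ lam / 2 ^ 1 := by 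
        gcongr
        · norm_num
        · omega
    _ = lam / 2 := by norm_num

theorem IsTwoSidedShell.congr {c Z lam δ : ℝ} {w w' g h : ℝ → ℝ} {R : Set ℝ}
    (H : IsTwoSidedShell c Z lam δ w g h univ) (hw : ∀ y ∈ R, w' y = w y) :
    IsTwoSidedShell c Z lam δ w' g h R := by
  refine ⟨H.right, H.left, H.right_far, H.left_far, ?_, ?_, H.core⟩
  · filter_upwards [H.right_eq] with y hy hR
    rw [hw y hR]
    exact hy trivial
  · filter_upwards [H.left_eq] with y hy hR
    rw [hw y hR]
    exact hy trivial

theorem IsTwoSidedShell.mass_right {c Z lam δ : ℝ} {w g h : ℝ → ℝ} {R : Set ℝ}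
    (H : IsTwoSidedShell c Z lam δ w g h R) {d : ℝ} (hR : Ico Z (Z + d) ⊆ R) :
    ∫⁻ y in Ico Z (Z + d), ENNReal.ofReal (w y) = ∫⁻ t in Ioc 0 d, ENNReal.ofReal (g t) := by
  rw [← setLIntegral_Ioc_sub_right (fun t => ENNReal.ofReal (g t)) Z,
    ← setLIntegral_congr Ico_ae_eq_Ioc]
  refine setLIntegral_congr_fun_ae measurableSet_Ico ?_
  filter_upwards [H.right_eq] with y hy hyI
  rw [hy (hR hyI) hyI.1]

theorem IsTwoSidedShell.mass_left {c Z lam δ : ℝ} {w g h : ℝ → ℝ} {R : Set ℝ}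
    (H : IsTwoSidedShell c Z lam δ w g h R) {d : ℝ} (hR : Ico (Z - d) Z ⊆ R) :
    ∫⁻ y in Ico (Z - d) Z, ENNReal.ofReal (w y) = ∫⁻ t in Ioc 0 d, ENNReal.ofReal (h t) := by
  rw [← setLIntegral_Ico_sub_left (fun t => ENNReal.ofReal (h t)) Z]
  refine setLIntegral_congr_fun_ae measurableSet_Ico ?_
  filter_upwards [H.left_eq] with y hy hyI
  rw [hy (hR hyI) hyI.2]

/-! ### Failure of doubling, and intervals with integer end points -/

/-- A measure that, at arbitrarily high ratios, is much larger to the right of some points than to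
the left is not doubling. -/
theorem not_isDoublingOn {a : ℝ} (ha0 : 0 < a) (ha1 : a < 1) {X : Set ℝ} {μ : Measure ℝ}
    (h : ∀ α : ℕ, 2 ≤ α → ∃ Z r : ℝ, 0 < r ∧ Ico (Z - 3 * r) (Z + r) ⊆ X ∧
      μ (Ico (Z - 2 * r) Z) ≤ ENNReal.ofReal (a ^ (α - 1) * (2 * r)) ∧
      ENNReal.ofReal ((2 - a) ^ (α - 1) * a * r) ≤ μ (Ico Z (Z + r))) :
    ¬ IsDoublingOn X μ := by
  rintro ⟨C, hC, hdoub⟩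
  have hratio : 1 < (2 - a) / a := by rw [one_lt_div ha0]; linarith
  obtain ⟨k, hk⟩ := pow_unbounded_of_one_lt ((C : ℝ) * 2 / a) hratio
  obtain ⟨Z, r, hr, hX, hl, hrt⟩ := h (k + 2) (by omega)
  have hlarge : (C : ℝ) * 2 / a < ((2 - a) / a) ^ (k + 1) :=
    hk.trans_le (pow_le_pow_right₀ hratio.le (by omega))
  have e1 : Z - r - 2 * r = Z - 3 * r := by ring
  have e2 : Z - r + 2 * r = Z + r := by ring
  have e3 : Z - r - r = Z - 2 * r := by ring
  -- The test interval `[Z - 2r, Z)` lies on the light side, while its double `[Z - 3r, Z + r)`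
  -- contains `[Z, Z + r)` on the heavy side.
  have hd := hdoub (Z - r) r hr (by rw [e1, e2]; exact hX)
  rw [e1, e2, e3, sub_add_cancel] at hd
  have h1 : ENNReal.ofReal ((2 - a) ^ (k + 1) * a * r) ≤
      ENNReal.ofReal (C * (a ^ (k + 1) * (2 * r))) := by
    calc _ ≤ μ (Ico Z (Z + r)) := hrt
      _ ≤ μ (Ico (Z - 3 * r) (Z + r)) := measure_mono (Ico_subset_Ico_left (by linarith))
      _ ≤ C * ENNReal.ofReal (a ^ (k + 1) * (2 * r)) := hd.trans (by gcongr; exact hl)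
      _ = _ := by rw [ENNReal.ofReal_mul C.coe_nonneg, ENNReal.ofReal_coe_nnreal]
  rw [ENNReal.ofReal_le_ofReal_iff (by positivity)] at h1
  rw [div_pow, div_lt_div_iff₀ ha0 (by positivity)] at hlarge
  nlinarith

theorem int_interval_bounds {A B : ℝ} (hA : 0 ≤ A) (hB : 0 ≤ B) {μ : Measure ℝ}
    (h : ∀ z : ℤ, ENNReal.ofReal A ≤ μ (Ico (z : ℝ) (z + 1)) ∧
      μ (Ico (z : ℝ) (z + 1)) ≤ ENNReal.ofReal B) (z : ℤ) (N : ℕ) :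
    ENNReal.ofReal (N * A) ≤ μ (Ico (z : ℝ) (z + N)) ∧
      μ (Ico (z : ℝ) (z + N)) ≤ ENNReal.ofReal (N * B) := by
  induction N with
  | zero => simp
  | succ N ih =>
    have hu := h (z + N)
    push_cast at hu
    have e : μ (Ico (z : ℝ) (z + (N + 1 : ℕ))) =
        μ (Ico (z : ℝ) (z + N)) + μ (Ico (z + N : ℝ) (z + N + 1)) := by
      rw [← measure_union (Ico_disjoint_Ico_same) measurableSet_Ico,
        Ico_union_Ico_eq_Ico (by linarith [N.cast_nonneg (α := ℝ)]) (by linarith)]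
      push_cast
      rw [add_assoc]
    rw [e]
    push_cast
    rw [add_mul, add_mul, one_mul, one_mul, ENNReal.ofReal_add (by positivity) hA,
      ENNReal.ofReal_add (by positivity) hB]
    exact ⟨add_le_add ih.1 hu.1, add_le_add ih.2 hu.2⟩

theorem adicInterval_subset_unit {n : ℕ} (hn : 0 < n) {m : ℤ} (hm : 0 ≤ m) (k : ℤ) :
    ∃ z : ℤ, adicInterval n m k ⊆ Ico (z : ℝ) (z + 1) := by
  obtain ⟨M, rfl⟩ := Int.eq_ofNat_of_zero_le hm
  have hpos : (0 : ℤ) < (n : ℤ) ^ M := by positivity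
  have hposR : (0 : ℝ) < (n : ℝ) ^ M := by positivity
  refine ⟨(k - 1) / (n : ℤ) ^ M, ?_⟩
  have h1 : ((k - 1) / (n : ℤ) ^ M) * (n : ℤ) ^ M ≤ k - 1 := Int.ediv_mul_le _ hpos.ne'
  have h2 : k ≤ ((k - 1) / (n : ℤ) ^ M + 1) * (n : ℤ) ^ M := by
    have := Int.lt_ediv_add_one_mul_self (k - 1) hpos
    omega
  have h1' : (((k - 1) / (n : ℤ) ^ M : ℤ) : ℝ) * (n : ℝ) ^ M ≤ k - 1 := by exact_mod_cast h1
  have h2' : (k : ℝ) ≤ ((((k - 1) / (n : ℤ) ^ M : ℤ) : ℝ) + 1) * (n : ℝ) ^ M := by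
    exact_mod_cast h2
  rw [adicInterval, zpow_natCast]
  refine Ico_subset_Ico ?_ ?_
  · rwa [le_div_iff₀ hposR]
  · rwa [div_le_iff₀ hposR]

/-- The children of `[(k-1)/n^m, k/n^m)` have integer end points if `m < 0` or `n = 1`. -/
theorem adicChild_eq_int {n : ℕ} (hn : 0 < n) {m : ℤ} (hm : m < 0 ∨ n = 1) (k : ℤ) :
    ∃ N : ℕ, 1 ≤ N ∧ ∀ j : ℕ, ∃ z : ℤ, adicChild n m k j = Ico (z : ℝ) (z + N) := by
  rcases hm with hm | rfl
  · obtain ⟨M, rfl⟩ : ∃ M : ℕ, m = -(M + 1 : ℤ) := ⟨(-m - 1).toNat, by omega⟩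
    refine ⟨n ^ M, Nat.one_le_pow _ _ hn, fun j => ⟨(k - 1) * n ^ (M + 1) + (j - 1) * n ^ M, ?_⟩⟩
    have hnR : (n : ℝ) ≠ 0 := by positivity
    rw [adicChild, show -(M + 1 : ℤ) + 1 = -(M : ℤ) by ring,
      show -(M + 1 : ℤ) = -((M + 1 : ℕ) : ℤ) by push_cast; ring, zpow_neg, zpow_neg,
      zpow_natCast, zpow_natCast]
    push_cast
    congr 1 <;> (field_simp; try ring)
  · refine ⟨1, le_rfl, fun j => ⟨k - 1 + (j - 1), ?_⟩⟩
    rw [adicChild]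
    push_cast
    simp only [one_zpow, div_one]
    congr 1
    ring

theorem childrenComparable_of_unit_bounds {A B : ℝ} (hA : 0 < A) (hB : 0 ≤ B) {μ : Measure ℝ}
    (h : ∀ z : ℤ, ENNReal.ofReal A ≤ μ (Ico (z : ℝ) (z + 1)) ∧
      μ (Ico (z : ℝ) (z + 1)) ≤ ENNReal.ofReal B) {n : ℕ} (hn : 0 < n) {m : ℤ}
    (hm : m < 0 ∨ n = 1) (k : ℤ) : ChildrenComparable (B / A) n m k μ := by
  obtain ⟨N, hN, hz⟩ := adicChild_eq_int hn hm k
  have hN' : (0 : ℝ) < N := by exact_mod_cast hN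
  refine ⟨N * A, by positivity, fun j _ => ?_⟩
  obtain ⟨z, hz⟩ := hz j
  rw [hz, show B / A * (N * A) = N * B by field_simp]
  exact int_interval_bounds hA.le hB h z N

/-! ### The measure on the real line -/

theorem ahMeasure_apply (a : ℝ) (x : ℕ → ℕ) {K : Set ℝ} (hK : MeasurableSet K) :
    ahMeasure a x K = ∫⁻ y in K, ENNReal.ofReal (blockWeight a (⌊y⌋₊ : ℝ) ⌊y⌋₊ (x ⌊y⌋₊) y) :=
  withDensity_apply _ hK

theorem isTwoSidedShell_ah {a : ℝ} (ha0 : 0 < a) (ha1 : a < 1) {α : ℕ} (hα : 1 ≤ α)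
    (x : ℕ → ℕ) :
    IsTwoSidedShell (4 / a ^ 2) ((α : ℤ) + 1 / 2 ^ x α) (1 / 2 ^ x α)
      (1 / 2 ^ x α / 2 ^ (2 * α)) (fun y => blockWeight a (⌊y⌋₊ : ℝ) ⌊y⌋₊ (x ⌊y⌋₊) y)
      (rightProfile a (2 - a) (1 / 2 ^ x α) α) (leftProfile a (1 / 2 ^ x α) 1 α)
      (Ico ((α : ℤ) : ℝ) ((α : ℤ) + 1)) := by
  simp only [Int.cast_natCast]
  refine (isTwoSidedShell_block ha0 ha1 hα (x α) α).congr fun y hy => ?_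
  have : ⌊y⌋₊ = α := (Nat.floor_eq_iff (α.cast_nonneg.trans hy.1)).2 hy
  simp only [this]

theorem ahMeasure_eq_volume_of_lt_one {a : ℝ} {x : ℕ → ℕ} {K : Set ℝ} (hm : MeasurableSet K)
    (hK : ∀ y ∈ K, y < 1) : ahMeasure a x K = volume K := by
  rw [ahMeasure_apply a x hm, setLIntegral_congr_fun (g := fun _ => 1) hm fun y hy => ?_]
  · simp
  -- The natural floor is `0` on all of `(-∞, 1)`, negative numbers included, and `blockWeight` is
  -- `1` for `α = 0`.
  · have : ⌊y⌋₊ = 0 := Nat.floor_eq_zero.2 (hK y hy)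
    simp [this, blockWeight]

theorem one_le_four_div_sq {a : ℝ} (ha0 : 0 < a) (ha1 : a < 1) : 1 ≤ 4 / a ^ 2 := by
  rw [le_div_iff₀ (by positivity)]
  nlinarith

theorem ahMeasure_unit_bounds {a : ℝ} (ha0 : 0 < a) (ha1 : a < 1) {S : Finset ℕ} {x : ℕ → ℕ}
    (hx : IsGoodSequence S x) (z : ℤ) :
    ENNReal.ofReal (1 / (4 * (4 / a ^ 2) ^ 2)) ≤ ahMeasure a x (Ico (z : ℝ) (z + 1)) ∧
      ahMeasure a x (Ico (z : ℝ) (z + 1)) ≤ ENNReal.ofReal (5 * (4 / a ^ 2)) := by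
  have hc := one_le_four_div_sq ha0 ha1
  set c := 4 / a ^ 2
  rcases le_or_gt z 0 with hz | hz
  · have hz' : (z : ℝ) ≤ 0 := by exact_mod_cast hz
    rw [ahMeasure_eq_volume_of_lt_one measurableSet_Ico fun y hy => by linarith [hy.2],
      Real.volume_Ico]
    constructor <;> apply ENNReal.ofReal_le_ofReal
    · rw [div_le_iff₀ (by positivity)]
      nlinarith
    · linarith
  · obtain ⟨α, rfl⟩ := Int.eq_ofNat_of_zero_le hz.le
    have hα : 1 ≤ α := by omega
    have H := isTwoSidedShell_ah ha0 ha1 hα x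
    have hlam : (0 : ℝ) < 1 / 2 ^ x α := by positivity
    have hhalf := hx.half_le hα
    rw [ahMeasure_apply a x measurableSet_Ico]
    refine ⟨H.le_mass hc one_pos subset_rfl (by linarith),
      (H.mass_le hc hlam zero_le_one subset_rfl).trans (ENNReal.ofReal_le_ofReal ?_)⟩
    nlinarith

theorem ahMeasure_isAdicDoublingOn {a : ℝ} (ha0 : 0 < a) (ha1 : a < 1) {S : Finset ℕ}
    {x : ℕ → ℕ} (hx : IsGoodSequence S x) {n : ℕ} (hnS : n ∈ S) (hn : 0 < n) :
    IsAdicDoublingOn n univ (ahMeasure a x) := by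
  have hc := one_le_four_div_sq ha0 ha1
  set c := 4 / a ^ 2 with hcdef
  have hc0 : 0 < c := by linarith
  have hn1 : (1 : ℝ) ≤ n := by exact_mod_cast hn
  have hc2 : c ^ 3 ≤ c ^ 5 := pow_le_pow_right₀ hc (by norm_num)
  have hc6 : 1 ≤ c ^ 5 := one_le_pow₀ hc
  have hcn : 0 < 16 * n * c ^ (n + 6) := by positivity
  refine isAdicDoublingOn_of_childrenComparable (C := 16 * n * c ^ (n + 6) + 68 * c ^ 5)
    (by positivity) fun m k _ => ?_
  by_cases hm : m < 0 ∨ n = 1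
  · refine (childrenComparable_of_unit_bounds (by positivity) (by positivity)
      (ahMeasure_unit_bounds ha0 ha1 hx) hn hm k).mono ?_
    rw [← hcdef, show 5 * c / (1 / (4 * c ^ 2)) = 20 * c ^ 3 by field_simp; ring]
    linarith
  · push Not at hm
    obtain ⟨z, hz⟩ := adicInterval_subset_unit hn hm.1 k
    rcases le_or_gt z 0 with hz0 | hz0
    · have hz0' : (z : ℝ) ≤ 0 := by exact_mod_cast hz0
      refine ⟨((n : ℝ) ^ m)⁻¹ / n, by positivity, fun j hj => ?_⟩
      rw [ahMeasure_eq_volume_of_lt_one (by exact measurableSet_Ico) fun y hy => by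
        linarith [(hz (adicChild_subset hn m k hj hy)).2], adicChild_eq hn, Real.volume_Ico,
        add_sub_cancel_left]
      refine ⟨le_rfl, ENNReal.ofReal_le_ofReal (le_mul_of_one_le_left (by positivity) ?_)⟩
      linarith
    · obtain ⟨α, rfl⟩ := Int.eq_ofNat_of_zero_le hz0.le
      have hα : 1 ≤ α := by omega
      have hlam : (0 : ℝ) < 1 / 2 ^ x α := by positivity
      have h2 : 2 ≤ n := by omega
      exact (isTwoSidedShell_ah ha0 ha1 hα x).childrenComparable hc hlam h2
        (hx.abs_sub_le hα hnS h2) (div_two_pow_le_half hlam hα) hm.1 hz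
        fun s t _ => ahMeasure_apply a x measurableSet_Ico

theorem ahMeasure_isLocallyFinite {a : ℝ} (ha0 : 0 < a) (ha1 : a < 1) {S : Finset ℕ}
    {x : ℕ → ℕ} (hx : IsGoodSequence S x) : IsLocallyFiniteMeasure (ahMeasure a x) := by
  refine ⟨fun y => ⟨Ico ((⌊y⌋ - 1 : ℤ) : ℝ) ((⌊y⌋ - 1 : ℤ) + (3 : ℕ)), ?_, ?_⟩⟩
  · refine Ico_mem_nhds ?_ ?_ <;> push_cast <;> linarith [Int.floor_le y, Int.lt_floor_add_one y]
  · exact ((int_interval_bounds (by positivity) (by positivity)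
      (ahMeasure_unit_bounds ha0 ha1 hx) _ 3).2).trans_lt ENNReal.ofReal_lt_top

theorem two_mul_div_two_pow {lam : ℝ} {α : ℕ} (hα : 1 ≤ α) :
    2 * (lam / 2 ^ α) = lam / 2 ^ (α - 1) := by
  obtain ⟨β, rfl⟩ : ∃ β, α = β + 1 := ⟨α - 1, by omega⟩
  rw [Nat.add_sub_cancel, pow_succ]
  field_simp

theorem ahMeasure_not_isDoublingOn {a : ℝ} (ha0 : 0 < a) (ha1 : a < 1) {S : Finset ℕ}
    {x : ℕ → ℕ} (hx : IsGoodSequence S x) : ¬ IsDoublingOn univ (ahMeasure a x) := by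
  refine not_isDoublingOn ha0 ha1 fun α hα => ?_
  have hα1 : 1 ≤ α := by omega
  have hlam : (0 : ℝ) < 1 / 2 ^ x α := by positivity
  have hhalf := hx.half_le hα1
  have H := isTwoSidedShell_ah ha0 ha1 hα1 x
  set lam : ℝ := 1 / 2 ^ x α with hlamdef
  have h2r := two_mul_div_two_pow (lam := lam) hα1
  have hr : lam / 2 ^ α ≤ lam := div_le_self hlam.le (one_le_pow₀ (by norm_num))
  have h2r' : lam / 2 ^ (α - 1) ≤ lam := div_le_self hlam.le (one_le_pow₀ (by norm_num))
  refine ⟨(α : ℤ) + lam, lam / 2 ^ α, by positivity, subset_univ _, ?_, ?_⟩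
  · rw [h2r, ahMeasure_apply a x measurableSet_Ico,
      H.mass_left (Ico_subset_Ico (by linarith) (by linarith)),
      mass_leftProfile_inner ha0 ha1 hlam hα1, Nat.sub_add_cancel hα1]
    exact ENNReal.ofReal_le_ofReal (mul_le_mul_of_nonneg_right
      (pow_le_pow_of_le_one ha0.le ha1.le (by omega)) (by positivity))
  · rw [ahMeasure_apply a x measurableSet_Ico,
      H.mass_right (Ico_subset_Ico (by linarith) (by linarith)),
      mass_rightProfile_inner ha0 ha1 ⟨by linarith, le_rfl⟩ hlam hα1]
    refine ENNReal.ofReal_le_ofReal (mul_le_mul_of_nonneg_right ?_ (by positivity))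
    have : 0 < (2 - a) ^ (α - 1) * a := mul_pos (pow_pos (by linarith) _) ha0
    nlinarith

/-- Together with `ahMeasure_beyond_block`, this separates measures with different first scales: a
smaller first block ends before this interval begins, and then its mass is its length. -/
theorem ahMeasure_right_half {a : ℝ} (ha0 : 0 < a) (ha1 : a < 1) {S : Finset ℕ}
    {x : ℕ → ℕ} (hx : IsGoodSequence S x) :
    ahMeasure a x (Ico (1 + 1 / 2 ^ x 1) (1 + 1 / 2 ^ x 1 + 1 / 2 ^ x 1)) =
      ENNReal.ofReal ((2 - a) * (1 / 2 ^ x 1)) := by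
  have hlam : (0 : ℝ) < 1 / 2 ^ x 1 := by positivity
  have hhalf := hx.half_le le_rfl
  have H := isTwoSidedShell_ah ha0 ha1 le_rfl x
  simp only [Int.cast_one, Nat.cast_one] at H
  rw [ahMeasure_apply a x measurableSet_Ico,
    H.mass_right (Ico_subset_Ico (by linarith) (by linarith)),
    mass_rightProfile ha0 ha1 ⟨by linarith, le_rfl⟩ hlam]

theorem ahMeasure_beyond_block {a : ℝ} (ha0 : 0 < a) (ha1 : a < 1) (x : ℕ → ℕ) {s t : ℝ}
    (hs : 1 + 2 / 2 ^ x 1 ≤ s) (ht : t ≤ 2) :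
    ahMeasure a x (Ico s t) = ENNReal.ofReal (t - s) := by
  have hlam : (0 : ℝ) < 1 / 2 ^ x 1 := by positivity
  have e : (2 : ℝ) / 2 ^ x 1 = 2 * (1 / 2 ^ x 1) := by ring
  rw [e] at hs
  have H := isTwoSidedShell_ah ha0 ha1 le_rfl x
  simp only [Int.cast_one, Nat.cast_one] at H
  rw [ahMeasure_apply a x measurableSet_Ico, ← Real.volume_Ico,
    setLIntegral_congr_fun_ae (g := fun _ => 1) measurableSet_Ico, setLIntegral_one]
  filter_upwards [H.right_eq, (countable_singleton s).ae_notMem volume] with y hy hys hyI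
  have hlt : s < y := lt_of_le_of_ne hyI.1 (fun h => hys h.symm)
  rw [hy ⟨by linarith, by linarith [hyI.2]⟩ (by linarith), H.right_far _ (by linarith),
    ENNReal.ofReal_one]

/-- Good sequences have arbitrarily large first terms; one sequence chosen for each attained first
term gives an injection from an infinite set into the family. -/
theorem infinite_of_first_term {S : Finset ℕ} (Φ : (ℕ → ℕ) → Measure ℝ)
    (hΦ : ∀ x y, IsGoodSequence S x → IsGoodSequence S y → x 1 < y 1 → Φ x ≠ Φ y) :
    {μ | ∃ x, IsGoodSequence S x ∧ μ = Φ x}.Infinite := by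
  choose f hf hf1 using exists_isGoodSequence S
  have hD : (range fun M => f M 1).Infinite :=
    infinite_of_forall_exists_gt fun M =>
      ⟨f (M + 1) 1, ⟨M + 1, rfl⟩, (Nat.lt_succ_self M).trans_le (hf1 _)⟩
  choose! g hg using fun d (hd : d ∈ range fun M => f M 1) => hd
  refine infinite_of_injOn_mapsTo (f := fun d => Φ (f (g d))) (fun d hd e he hde => ?_)
    (fun d _ => ⟨f (g d), hf _, rfl⟩) hD
  rcases lt_trichotomy d e with h | h | h
  · refine absurd hde (hΦ _ _ (hf _) (hf _) ?_)
    have h1 : f (g d) 1 = d := hg d hd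
    have h2 : f (g e) 1 = e := hg e he
    omega
  · exact h
  · refine absurd hde.symm (hΦ _ _ (hf _) (hf _) ?_)
    have h1 : f (g d) 1 = d := hg d hd
    have h2 : f (g e) 1 = e := hg e he
    omega

theorem two_div_pow_le_of_lt {p q : ℕ} (h : p < q) : (2 : ℝ) / 2 ^ q ≤ 1 / 2 ^ p := by
  obtain ⟨r, rfl⟩ : ∃ r, q = r + 1 := ⟨q - 1, by omega⟩
  rw [pow_succ, div_mul_eq_div_div_swap, div_self two_ne_zero]
  gcongr
  · norm_num
  · omega

theorem ahMeasure_ne {a : ℝ} (ha0 : 0 < a) (ha1 : a < 1) {S : Finset ℕ} {x y : ℕ → ℕ}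
    (hx : IsGoodSequence S x) (hxy : x 1 < y 1) : ahMeasure a x ≠ ahMeasure a y := by
  intro h
  have hlam : (0 : ℝ) < 1 / 2 ^ x 1 := by positivity
  have hhalf := hx.half_le le_rfl
  have h1 := ahMeasure_right_half ha0 ha1 hx
  rw [h, ahMeasure_beyond_block ha0 ha1 y (by linarith [two_div_pow_le_of_lt hxy]) (by linarith),
    add_sub_cancel_left, ENNReal.ofReal_eq_ofReal_iff hlam.le (by nlinarith)] at h1
  nlinarith

/-! ### The measure on the unit interval -/

/-- The part of the block of the compactified procedure where the density may be changed. -/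
def compactBlock (x : ℕ → ℕ) (α : ℕ) : Set ℝ := Icc (1 / 2 ^ x α / 2) (2 * (1 / 2 ^ x α))

/-- The complement of all blocks except possibly one. -/
def awayFromOthers (x : ℕ → ℕ) (α : ℕ) : Set ℝ :=
  {y | ∀ β, 1 ≤ β → β ≠ α → y ∉ compactBlock x β}

theorem compactBlockWeight_eq_one (a : ℝ) {x : ℕ → ℕ} {α : ℕ} {y : ℝ}
    (hy : 1 ≤ α → y ∉ compactBlock x α) : compactBlockWeight a α (x α) y = 1 := by
  rcases Nat.eq_zero_or_pos α with rfl | hα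
  · simp [compactBlockWeight]
  have hlam : (0 : ℝ) < 1 / 2 ^ x α := by positivity
  have hy' := hy hα
  rcases lt_or_ge y (1 / 2 ^ x α / 2) with h | h
  · rw [compactBlockWeight_left hα.ne' (by linarith)]
    exact leftProfile_far (by positivity) (by linarith)
  · have h2 : 2 * (1 / 2 ^ x α) < y := by
      by_contra! hcon
      exact hy' ⟨h, hcon⟩
    rw [compactBlockWeight_right hα.ne' (by linarith) fun k => ?_]
    · exact rightProfile_far hlam (by linarith)
    · have : 1 / 2 ^ x α / (2 : ℝ) ^ k ≤ 1 / 2 ^ x α :=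
        div_le_self hlam.le (one_le_pow₀ (by norm_num))
      linarith

theorem finprod_compactBlockWeight (a : ℝ) {x : ℕ → ℕ} {α : ℕ} {y : ℝ}
    (hy : y ∈ awayFromOthers x α) :
    ∏ᶠ β, compactBlockWeight a β (x β) y = compactBlockWeight a α (x α) y :=
  finprod_eq_single _ α fun β hβ => compactBlockWeight_eq_one a fun h => hy β h hβ

theorem finprod_compactBlockWeight_eq_one (a : ℝ) {x : ℕ → ℕ} {y : ℝ}
    (hy : ∀ β, 1 ≤ β → y ∉ compactBlock x β) : ∏ᶠ β, compactBlockWeight a β (x β) y = 1 :=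
  finprod_eq_one_of_forall_eq_one fun β => compactBlockWeight_eq_one a fun h => hy β h

theorem isTwoSidedShell_compact {a : ℝ} (ha0 : 0 < a) (ha1 : a < 1) {α : ℕ} (hα : 1 ≤ α)
    (x : ℕ → ℕ) :
    IsTwoSidedShell (4 / a ^ 2) (1 / 2 ^ x α) (1 / 2 ^ x α) (1 / 2 ^ x α / 2 ^ (2 * α))
      (fun y => ∏ᶠ β, compactBlockWeight a β (x β) y)
      (rightProfile a ((3 - a) / 2) (1 / 2 ^ x α) α) (leftProfile a (1 / 2 ^ x α / 2) 2 α)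
      (awayFromOthers x α) :=
  (isTwoSidedShell_compactBlock ha0 ha1 hα (x α)).congr fun _ hy => finprod_compactBlockWeight a hy

theorem ahCompactMeasure_apply (a : ℝ) (x : ℕ → ℕ) {K : Set ℝ} (hK : MeasurableSet K)
    (hsub : K ⊆ Icc 0 1) :
    ahCompactMeasure a x K =
      ∫⁻ y in K, ENNReal.ofReal (∏ᶠ β, compactBlockWeight a β (x β) y) := by
  rw [ahCompactMeasure, withDensity_apply _ hK, Measure.restrict_restrict hK,
    inter_eq_left.2 hsub]

namespace IsGoodSequence

variable {S : Finset ℕ} {x : ℕ → ℕ}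

theorem add_four_le (h : IsGoodSequence S x) {α β : ℕ} (hα : 1 ≤ α) (hαβ : α < β) :
    x α + 4 ≤ x β := by
  induction β, hαβ using Nat.le_induction with
  | base => exact h.gap α hα
  | succ β hβ ih =>
    have := h.gap β (by omega)
    omega

theorem scale_le (h : IsGoodSequence S x) {α β : ℕ} (hα : 1 ≤ α) (hαβ : α < β) :
    (1 : ℝ) / 2 ^ x β ≤ 1 / 2 ^ x α / 16 := by
  have := h.add_four_le hα hαβ
  calc (1 : ℝ) / 2 ^ x β ≤ 1 / 2 ^ (x α + 4) := by gcongr; norm_num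
    _ = 1 / 2 ^ x α / 16 := by rw [pow_add, div_div]; norm_num

theorem self_le (h : IsGoodSequence S x) {α : ℕ} (hα : 1 ≤ α) : α ≤ x α := by
  induction α, hα using Nat.le_induction with
  | base => exact h.one_le 1 le_rfl
  | succ α hα ih =>
    have := h.gap α hα
    omega

/-- The gap `4` makes scales shrink by `16`: for `α < β`, points of block `α` are at least `lam / 2`
and points of block `β` at most `lam / 8`, where `lam = 1 / 2 ^ x α`. Their ratio is at least `4`,
too much for an interval with `t ≤ 2 * s`. -/
theorem eq_of_mem_compactBlock (h : IsGoodSequence S x) {s t y z : ℝ} (hs : t ≤ 2 * s)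
    (hy : y ∈ Icc s t) (hz : z ∈ Icc s t) {α β : ℕ} (hα : 1 ≤ α) (hβ : 1 ≤ β)
    (hyα : y ∈ compactBlock x α) (hzβ : z ∈ compactBlock x β) : α = β := by
  have key : ∀ {y z : ℝ}, y ∈ Icc s t → z ∈ Icc s t → ∀ {α β : ℕ}, 1 ≤ α →
      y ∈ compactBlock x α → z ∈ compactBlock x β → ¬ α < β := by
    intro y z hy hz α β hα hyα hzβ hlt
    have := h.scale_le hα hlt
    have : (0 : ℝ) < 1 / 2 ^ x α := by positivity
    linarith [hy.1, hy.2, hz.1, hz.2, hyα.1, hyα.2, hzβ.1, hzβ.2]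
  have h1 := key hy hz hα hyα hzβ
  have h2 := key hz hy hβ hzβ hyα
  omega

theorem compactBlock_subset (h : IsGoodSequence S x) {α : ℕ} (hα : 1 ≤ α) :
    compactBlock x α ⊆ awayFromOthers x α := fun y hy β hβ hne hyβ =>
  hne (by
    have hy0 : 0 < y := lt_of_lt_of_le (by positivity) hy.1
    have hmem : y ∈ Icc y y := ⟨le_rfl, le_rfl⟩
    exact h.eq_of_mem_compactBlock (by linarith) hmem hmem hβ hα hyβ hy)

/-- An interval that is short compared with its distance to `0` meets at most one block, and the
block can be chosen below the interval if it meets none. -/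
theorem exists_subset_awayFromOthers (h : IsGoodSequence S x) {s t : ℝ} (hs : 0 < s)
    (hst : t ≤ 2 * s) (hst' : s ≤ t) :
    ∃ α, 1 ≤ α ∧ Ico s t ⊆ awayFromOthers x α ∧ (1 : ℝ) / 2 ^ x α ≤ 2 * t := by
  by_cases hmeet : ∃ y ∈ Ico s t, ∃ α, 1 ≤ α ∧ y ∈ compactBlock x α
  · obtain ⟨y, hy, α, hα, hyα⟩ := hmeet
    refine ⟨α, hα, fun z hz β hβ hne hzβ => hne ?_, by linarith [hy.2, hyα.1]⟩
    exact h.eq_of_mem_compactBlock hst ⟨hz.1, hz.2.le⟩ ⟨hy.1, hy.2.le⟩ hβ hα hzβ hyα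
  · push Not at hmeet
    -- If no block is met, any index serves; a large one secures the bound on the scale needed for
    -- mass estimates.
    obtain ⟨k, hk⟩ := exists_pow_lt_of_lt_one (show 0 < 2 * t by linarith)
      (show (1 / 2 : ℝ) < 1 by norm_num)
    refine ⟨k + 1, by omega, fun z hz β hβ _ => hmeet z hz β hβ, ?_⟩
    have := h.self_le (show 1 ≤ k + 1 by omega)
    calc (1 : ℝ) / 2 ^ x (k + 1) ≤ 1 / 2 ^ k := by
          gcongr
          · norm_num
          · omega
      _ = (1 / 2) ^ k := by rw [div_pow, one_pow]
      _ ≤ 2 * t := hk.le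

/-- Each shell `(u / 2, u]` meets at most one block, of scale at most `2 * u`, so `mass_le` bounds
its mass by a multiple of `u`; the shells then sum geometrically. -/
theorem mass_Ico_zero_le (h : IsGoodSequence S x) {a : ℝ} (ha0 : 0 < a) (ha1 : a < 1) {t : ℝ}
    (ht : 0 < t) (ht1 : t ≤ 1) :
    ahCompactMeasure a x (Ico 0 t) ≤ ENNReal.ofReal (34 * (4 / a ^ 2) * t) := by
  have hc := one_le_four_div_sq ha0 ha1
  set c := 4 / a ^ 2
  rw [ahCompactMeasure_apply a x measurableSet_Ico (Ico_subset_Icc_self.trans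
    (Icc_subset_Icc_right ht1))]
  set f : ℝ → ℝ≥0∞ := fun y => ENNReal.ofReal (∏ᶠ β, compactBlockWeight a β (x β) y)
  have hshell : ∀ u, 0 < u → ∫⁻ y in Ioc (u / 2) u, f y ≤ ENNReal.ofReal (17 * c * u) := by
    intro u hu
    obtain ⟨α, hα, hsub, hle⟩ :=
      h.exists_subset_awayFromOthers (s := u / 2) (t := u) (by linarith) (by linarith)
        (by linarith)
    have H := isTwoSidedShell_compact ha0 ha1 hα x
    rw [← setLIntegral_congr Ico_ae_eq_Ioc]
    have hlam : (0 : ℝ) < 1 / 2 ^ x α := by positivity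
    have := H.mass_le hc hlam (s := u / 2) (ℓ := u / 2) (by linarith) (by rwa [add_halves])
    rw [add_halves] at this
    refine this.trans (ENNReal.ofReal_le_ofReal ?_)
    nlinarith
  calc ∫⁻ y in Ico 0 t, f y ≤ ∫⁻ y in ⋃ i : ℕ, Ioc (t / 2 ^ i / 2) (t / 2 ^ i), f y := by
        rw [setLIntegral_congr Ico_ae_eq_Ioc]
        refine lintegral_mono_set fun y hy => ?_
        obtain ⟨i, h1, h2⟩ := exists_shell hy.1 hy.2
        rw [pow_succ, ← div_div] at h1
        exact mem_iUnion.2 ⟨i, h1, h2⟩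
    _ ≤ ∑' i : ℕ, ∫⁻ y in Ioc (t / 2 ^ i / 2) (t / 2 ^ i), f y := lintegral_iUnion_le _ _
    _ ≤ ∑' i : ℕ, ENNReal.ofReal (17 * c * t * (1 / 2) ^ i) := by
        refine ENNReal.tsum_le_tsum fun i => (hshell (t / 2 ^ i) (by positivity)).trans ?_
        apply le_of_eq
        congr 1
        rw [div_pow, one_pow]
        ring
    _ = ENNReal.ofReal (34 * c * t) := by
        rw [← ENNReal.ofReal_tsum_of_nonneg (fun i => by positivity)
          (summable_geometric_two.mul_left _), tsum_mul_left, tsum_geometric_two]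
        congr 1
        ring

/-- The mass of an interval that is long compared with its distance to `0` is comparable to its
length. -/
theorem mass_near_zero (h : IsGoodSequence S x) {a : ℝ} (ha0 : 0 < a) (ha1 : a < 1) {n : ℕ}
    (hn : 1 ≤ n) {s ℓ : ℝ} (hs : 0 ≤ s) (hℓ : 0 < ℓ) (h1 : s + ℓ ≤ 1) (hsn : s + ℓ ≤ n * ℓ) :
    ENNReal.ofReal (ℓ / (8 * (4 / a ^ 2) ^ (n + 5))) ≤ ahCompactMeasure a x (Ico s (s + ℓ)) ∧
      ahCompactMeasure a x (Ico s (s + ℓ)) ≤ ENNReal.ofReal (34 * (4 / a ^ 2) * n * ℓ) := by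
  have hc := one_le_four_div_sq ha0 ha1
  refine ⟨?_, ?_⟩
  · set c := 4 / a ^ 2
    have hn1 : (1 : ℝ) ≤ n := by exact_mod_cast hn
    set t := s + ℓ with ht
    have ht0 : 0 < t := by linarith
    have hm1 := le_max_left s (t / 2)
    have hm2 := le_max_right s (t / 2)
    have hhalf : ℓ / 2 ≤ t - max s (t / 2) := by
      have : max s (t / 2) ≤ t - ℓ / 2 := max_le (by linarith) (by linarith)
      linarith
    set s' := max s (t / 2)
    -- Cutting at `max s (t / 2)` keeps at least half of the length and leaves an interval that
    -- meets at most one block.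
    obtain ⟨α, hα, hsub, hle⟩ := h.exists_subset_awayFromOthers (s := s') (t := t)
      (by linarith) (by linarith) (by linarith)
    have H := isTwoSidedShell_compact ha0 ha1 hα x
    have hpow : (n : ℝ) ≤ 2 ^ n := by exact_mod_cast (Nat.lt_two_pow_self).le
    have hk : 4 * (1 / 2 ^ x α) < 2 ^ (n + 5) * (t - s') := by
      calc 4 * (1 / 2 ^ x α) ≤ 4 * (2 * t) := by gcongr
        _ ≤ 8 * (n * ℓ) := by linarith
        _ < 16 * (n * ℓ) := by
          have : 0 < n * ℓ := by positivity
          linarith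
        _ = 32 * n * (ℓ / 2) := by ring
        _ ≤ 32 * 2 ^ n * (t - s') := by gcongr
        _ = 2 ^ (n + 5) * (t - s') := by ring
    have hmass := H.le_mass hc (s := s') (ℓ := t - s') (by linarith)
      (by rwa [add_sub_cancel]) hk
    rw [add_sub_cancel] at hmass
    rw [ahCompactMeasure_apply a x measurableSet_Ico (Ico_subset_Icc_self.trans
      (Icc_subset_Icc hs h1))]
    refine le_trans (ENNReal.ofReal_le_ofReal ?_) (hmass.trans
      (lintegral_mono_set (Ico_subset_Ico_left hm1)))
    rw [show ℓ / (8 * c ^ (n + 5)) = (ℓ / 2) / (4 * c ^ (n + 5)) by rw [div_div]; ring_nf]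
    gcongr
  · refine (measure_mono (Ico_subset_Ico_left hs)).trans
      ((h.mass_Ico_zero_le ha0 ha1 (by linarith) h1).trans (ENNReal.ofReal_le_ofReal ?_))
    rw [mul_assoc _ (n : ℝ)]
    gcongr

end IsGoodSequence

theorem Ico_subset_unit {s t : ℝ} (hst : s < t) (h : Ico s t ⊆ Icc 0 1) : 0 ≤ s ∧ t ≤ 1 := by
  have := isClosed_Icc.closure_subset_iff.2 h
  rw [closure_Ico hst.ne] at this
  exact (Icc_subset_Icc_iff hst.le).1 this

theorem ahCompactMeasure_isAdicDoublingOn {a : ℝ} (ha0 : 0 < a) (ha1 : a < 1) {S : Finset ℕ}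
    {x : ℕ → ℕ} (hx : IsGoodSequence S x) {n : ℕ} (hnS : n ∈ S) (hn : 0 < n) :
    IsAdicDoublingOn n (Icc 0 1) (ahCompactMeasure a x) := by
  have hc := one_le_four_div_sq ha0 ha1
  have hn1 : (1 : ℝ) ≤ n := by exact_mod_cast hn
  refine isAdicDoublingOn_of_childrenComparable
    (C := 16 * n * (4 / a ^ 2) ^ (n + 6) + 68 * (4 / a ^ 2) ^ 5 + 272 * n * (4 / a ^ 2) ^ (n + 6))
    (by positivity) fun m k hX => ?_
  have hℓ : 0 < ((n : ℝ) ^ m)⁻¹ := by positivity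
  have hJ := adicInterval_eq n m k
  obtain ⟨h0, h1⟩ := Ico_subset_unit (by linarith) (hJ ▸ hX)
  have hk1 : 1 ≤ k := by
    have : 0 ≤ (k : ℝ) - 1 := by
      by_contra! hneg
      exact absurd h0 (not_le.2 (div_neg_of_neg_of_pos hneg (by positivity)))
    have : (1 : ℝ) ≤ k := by linarith
    exact_mod_cast this
  rcases hk1.eq_or_lt with rfl | hk2
  -- The interval starts at `0` and may contain infinitely many blocks; its children reach at most
  -- `n` times their length from `0`.
  · refine ChildrenComparable.mono (C := 272 * n * (4 / a ^ 2) ^ (n + 6))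
      (le_add_of_nonneg_left (by positivity)) ?_
    have hℓn : 0 < ((n : ℝ) ^ m)⁻¹ / n := by positivity
    refine ⟨((n : ℝ) ^ m)⁻¹ / n / (8 * (4 / a ^ 2) ^ (n + 5)), by positivity, fun j hj => ?_⟩
    have hsub := adicChild_subset hn m 1 hj
    rw [hJ, adicChild_eq hn] at hsub
    rw [adicChild_eq hn]
    obtain ⟨hs1, hs2⟩ := (Ico_subset_Ico_iff (by linarith)).1 hsub
    simp only [Int.cast_one, sub_self, zero_div, zero_add] at hs1 hs2 h1 ⊢
    have := hx.mass_near_zero ha0 ha1 hn hs1 hℓn (by linarith)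
      (by rw [mul_div_cancel₀ _ (by positivity)]; linarith)
    refine ⟨this.1, this.2.trans_eq ?_⟩
    congr 1
    rw [pow_succ _ (n + 5)]
    generalize 4 / a ^ 2 = c at *
    field_simp
    ring
  · refine ChildrenComparable.mono
      (C := 16 * n * (4 / a ^ 2) ^ (n + 6) + 68 * (4 / a ^ 2) ^ 5)
      (le_add_of_nonneg_right (by positivity)) ?_
    have hk : (1 : ℝ) ≤ (k : ℝ) - 1 := by
      have : (2 : ℝ) ≤ k := by exact_mod_cast hk2
      linarith
    have hs : ((n : ℝ) ^ m)⁻¹ ≤ ((k : ℝ) - 1) / (n : ℝ) ^ m := by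
      rw [← one_div]
      gcongr
    have hn2 : 2 ≤ n := by
      by_contra! hlt
      obtain rfl : n = 1 := by omega
      simp at h1 hs
      linarith
    have hm : 0 ≤ m := by
      by_contra! hneg
      have : 1 ≤ ((n : ℝ) ^ m)⁻¹ := by
        rw [← zpow_neg]
        exact one_le_zpow₀ hn1 (by omega)
      linarith
    -- For `k ≥ 2` the distance to `0` is at least the length, so a single block matters and the
    -- comparison around `1 / 2 ^ x α` applies, with integer part `0`.
    obtain ⟨α, hα, hsub, -⟩ := hx.exists_subset_awayFromOthers
      (s := ((k : ℝ) - 1) / (n : ℝ) ^ m) (t := ((k : ℝ) - 1) / (n : ℝ) ^ m + ((n : ℝ) ^ m)⁻¹)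
      (by linarith) (by linarith) (by linarith)
    have hlam : (0 : ℝ) < 1 / 2 ^ x α := by positivity
    have H := isTwoSidedShell_compact ha0 ha1 hα x
    have H' : IsTwoSidedShell (4 / a ^ 2) ((0 : ℤ) + 1 / 2 ^ x α) (1 / 2 ^ x α)
        (1 / 2 ^ x α / 2 ^ (2 * α)) (fun y => ∏ᶠ β, compactBlockWeight a β (x β) y)
        (rightProfile a ((3 - a) / 2) (1 / 2 ^ x α) α) (leftProfile a (1 / 2 ^ x α / 2) 2 α)
        (adicInterval n m k) := by
      rw [Int.cast_zero, zero_add]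
      rw [← hJ] at hsub
      exact ⟨H.right, H.left, H.right_far, H.left_far,
        H.right_eq.mono fun y hy hyJ => hy (hsub hyJ),
        H.left_eq.mono fun y hy hyJ => hy (hsub hyJ), H.core⟩
    exact H'.childrenComparable hc hlam hn2 (hx.abs_sub_le hα hnS hn2)
      (div_two_pow_le_half hlam hα) hm subset_rfl
      fun s t hst => ahCompactMeasure_apply a x measurableSet_Ico (hst.trans hX)

/-- The weight `(3 - a) / 2` balances the block: `a * lam / 2 + (3 - a) / 2 * lam = 3 / 2 * lam`,
with `lam = 1 / 2 ^ x α`. -/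
theorem mass_compactBlock {a : ℝ} (ha0 : 0 < a) (ha1 : a < 1) {S : Finset ℕ} {x : ℕ → ℕ}
    (hx : IsGoodSequence S x) {α : ℕ} (hα : 1 ≤ α) :
    ∫⁻ y in compactBlock x α, ENNReal.ofReal (∏ᶠ β, compactBlockWeight a β (x β) y) =
      volume (compactBlock x α) := by
  have hsub := hx.compactBlock_subset hα
  have H := isTwoSidedShell_compact ha0 ha1 hα x
  unfold compactBlock at *
  have hlam : (0 : ℝ) < 1 / 2 ^ x α := by positivity
  set lam : ℝ := 1 / 2 ^ x α
  have e : lam / 2 = lam - lam / 2 := by ring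
  rw [← setLIntegral_congr Ico_ae_eq_Icc, Real.volume_Icc,
    ← Ico_union_Ico_eq_Ico (b := lam) (by linarith) (by linarith),
    lintegral_union measurableSet_Ico Ico_disjoint_Ico_same, two_mul,
    H.mass_right (fun y hy => hsub ⟨by linarith [hy.1], by linarith [hy.2]⟩),
    mass_rightProfile ha0 ha1 ⟨by linarith, by linarith⟩ hlam]
  nth_rw 1 [e]
  rw [H.mass_left (fun y hy => hsub ⟨by linarith [hy.1], by linarith [hy.2]⟩),
    mass_leftProfile ha0 ha1 (by linarith), ← ENNReal.ofReal_add (by positivity)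
    (mul_nonneg (by linarith) hlam.le)]
  congr 1
  ring

theorem ahCompactMeasure_isProbability {a : ℝ} (ha0 : 0 < a) (ha1 : a < 1) {S : Finset ℕ}
    {x : ℕ → ℕ} (hx : IsGoodSequence S x) : IsProbabilityMeasure (ahCompactMeasure a x) := by
  constructor
  set f : ℝ → ℝ≥0∞ := fun y => ENNReal.ofReal (∏ᶠ β, compactBlockWeight a β (x β) y) with hf
  have htot : ahCompactMeasure a x univ = ∫⁻ y in Icc 0 1, f y := by
    rw [ahCompactMeasure, withDensity_apply _ MeasurableSet.univ, Measure.restrict_univ]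
  set U := ⋃ α : ℕ, compactBlock x (α + 1) with hU
  have hBm : ∀ α : ℕ, MeasurableSet (compactBlock x (α + 1)) := fun α => measurableSet_Icc
  have hUm : MeasurableSet U := MeasurableSet.iUnion hBm
  have hdisj : Pairwise (Function.onFun Disjoint fun α : ℕ => compactBlock x (α + 1)) := by
    intro α β hne
    refine disjoint_left.2 fun y hy hyβ => ?_
    exact hx.compactBlock_subset (by omega) hy (β + 1) (by omega) (by omega) hyβ
  have hUsub : U ⊆ Icc 0 1 := iUnion_subset fun α => by
    have hhalf := hx.half_le (show 1 ≤ α + 1 by omega)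
    exact Icc_subset_Icc (by positivity) (by linarith)
  have hUmass : ∫⁻ y in U, f y = volume U := by
    rw [hU, lintegral_iUnion hBm hdisj, measure_iUnion hdisj hBm]
    exact tsum_congr fun α => mass_compactBlock ha0 ha1 hx (by omega)
  have hrest : ∫⁻ y in Icc 0 1 \ U, f y = volume (Icc (0 : ℝ) 1 \ U) := by
    rw [setLIntegral_congr_fun (g := fun _ => 1) (measurableSet_Icc.diff hUm), setLIntegral_one]
    intro y hy
    simp only [hf]
    rw [finprod_compactBlockWeight_eq_one a, ENNReal.ofReal_one]
    intro β hβ hyβ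
    exact hy.2 (mem_iUnion.2 ⟨β - 1, by rwa [Nat.sub_add_cancel hβ]⟩)
  rw [htot, ← lintegral_inter_add_sdiff f (Icc 0 1) hUm, inter_eq_right.2 hUsub, hUmass, hrest,
    measure_add_sdiff hUm.nullMeasurableSet, union_eq_right.2 hUsub, Real.volume_Icc]
  simp

theorem ahCompactMeasure_not_isDoublingOn {a : ℝ} (ha0 : 0 < a) (ha1 : a < 1) {S : Finset ℕ}
    {x : ℕ → ℕ} (hx : IsGoodSequence S x) : ¬ IsDoublingOn (Icc 0 1) (ahCompactMeasure a x) := by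
  refine not_isDoublingOn ha0 ha1 fun α hα => ?_
  have hα1 : 1 ≤ α := by omega
  have hlam : (0 : ℝ) < 1 / 2 ^ x α := by positivity
  have hhalf := hx.half_le hα1
  have H := isTwoSidedShell_compact ha0 ha1 hα1 x
  have hsub := hx.compactBlock_subset hα1
  unfold compactBlock at hsub
  set lam : ℝ := 1 / 2 ^ x α with hlamdef
  -- The left profile starts at `lam / 2`, so `α - 2` halvings reach `2 * r`; this is why
  -- `not_isDoublingOn` asks only for `a ^ (α - 1)`.
  have h2r : 2 * (lam / 2 ^ α) = lam / 2 / 2 ^ (α - 2) := by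
    rw [two_mul_div_two_pow hα1, div_div lam 2, ← pow_succ', show α - 2 + 1 = α - 1 by omega]
  have h2r' : lam / 2 / 2 ^ (α - 2) ≤ lam / 2 :=
    div_le_self (by positivity) (one_le_pow₀ (by norm_num))
  have hr0 : 0 < lam / 2 ^ α := by positivity
  refine ⟨lam, lam / 2 ^ α, hr0, Ico_subset_Icc_self.trans
    (Icc_subset_Icc (by linarith) (by linarith)), ?_, ?_⟩
  · rw [ahCompactMeasure_apply a x measurableSet_Ico (Ico_subset_Icc_self.trans
      (Icc_subset_Icc (by linarith) (by linarith))), h2r,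
      H.mass_left (fun y hy => hsub ⟨by linarith [hy.1], by linarith [hy.2]⟩),
      mass_leftProfile_inner ha0 ha1 (by positivity) hα, show α - 2 + 1 = α - 1 by omega]
  · rw [ahCompactMeasure_apply a x measurableSet_Ico (Ico_subset_Icc_self.trans
      (Icc_subset_Icc (by linarith) (by linarith))),
      H.mass_right (fun y hy => hsub ⟨by linarith [hy.1], by linarith [hy.2]⟩),
      mass_rightProfile_inner ha0 ha1 ⟨by linarith, by linarith⟩ hlam hα1]
    refine ENNReal.ofReal_le_ofReal (mul_le_mul_of_nonneg_right ?_ hr0.le)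
    have : 0 < (2 - a) ^ (α - 1) * a := mul_pos (pow_pos (by linarith) _) ha0
    nlinarith

theorem ahCompactMeasure_ne {a : ℝ} (ha0 : 0 < a) (ha1 : a < 1) {S : Finset ℕ} {x y : ℕ → ℕ}
    (hx : IsGoodSequence S x) (hy : IsGoodSequence S y) (hxy : x 1 < y 1) :
    ahCompactMeasure a x ≠ ahCompactMeasure a y := by
  intro h
  have hlam : (0 : ℝ) < 1 / 2 ^ x 1 := by positivity
  have hhalf := hx.half_le le_rfl
  have hscale := two_div_pow_le_of_lt hxy
  have hunit : Ico ((1 : ℝ) / 2 ^ x 1) (1 / 2 ^ x 1 + 1 / 2 ^ x 1) ⊆ Icc 0 1 :=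
    Ico_subset_Icc_self.trans (Icc_subset_Icc (by positivity) (by linarith))
  have H := isTwoSidedShell_compact ha0 ha1 le_rfl x
  have h1 : ahCompactMeasure a x (Ico (1 / 2 ^ x 1) (1 / 2 ^ x 1 + 1 / 2 ^ x 1)) =
      ENNReal.ofReal ((3 - a) / 2 * (1 / 2 ^ x 1)) := by
    rw [ahCompactMeasure_apply a x measurableSet_Ico hunit,
      H.mass_right (fun z hz => hx.compactBlock_subset le_rfl
        ⟨by linarith [hz.1], by linarith [hz.2]⟩),
      mass_rightProfile ha0 ha1 ⟨by linarith, by linarith⟩ hlam]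
  have h2 : ahCompactMeasure a y (Ico (1 / 2 ^ x 1) (1 / 2 ^ x 1 + 1 / 2 ^ x 1)) =
      ENNReal.ofReal (1 / 2 ^ x 1) := by
    rw [ahCompactMeasure_apply a y measurableSet_Ico hunit,
      setLIntegral_congr_fun_ae (g := fun _ => 1) measurableSet_Ico, setLIntegral_one,
      Real.volume_Ico, add_sub_cancel_left]
    filter_upwards [(countable_singleton ((1 : ℝ) / 2 ^ x 1)).ae_notMem volume] with z hz hzI
    have hlt : 1 / 2 ^ x 1 < z := lt_of_le_of_ne hzI.1 fun he => hz he.symm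
    rw [finprod_compactBlockWeight_eq_one a, ENNReal.ofReal_one]
    intro β hβ hzβ
    have e : (2 : ℝ) / 2 ^ y 1 = 2 * (1 / 2 ^ y 1) := by ring
    have hle : (1 : ℝ) / 2 ^ y β ≤ 1 / 2 ^ y 1 := by
      rcases hβ.eq_or_lt with rfl | hβ'
      · exact le_rfl
      · have := hy.scale_le le_rfl hβ'
        have : (0 : ℝ) < 1 / 2 ^ y 1 := by positivity
        linarith
    linarith [hzβ.2]
  rw [h, h2, ENNReal.ofReal_eq_ofReal_iff hlam.le (by nlinarith)] at h1
  nlinarith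

theorem theorem1p1 (S : Finset ℕ) (hS : ∀ n ∈ S, 0 < n) (a : ℝ) (ha0 : 0 < a) (ha1 : a < 1) :
    (∃ F : Set (Measure ℝ), F.Infinite ∧ ∀ μ ∈ F,
      (∃ x : ℕ → ℕ, (∀ α, 1 ≤ α → IsGoodScale S α (x α)) ∧ μ = ahMeasure a x) ∧
      IsLocallyFiniteMeasure μ ∧
      (∀ n ∈ S, IsAdicDoublingOn n univ μ) ∧
      ¬ IsDoublingOn univ μ) ∧
    (∃ F : Set (Measure ℝ), F.Infinite ∧ ∀ μ ∈ F,
      (∃ x : ℕ → ℕ, (∀ α, 1 ≤ α → IsGoodScale S α (x α)) ∧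
        (∀ α, 1 ≤ α → x α + 2 ≤ x (α + 1)) ∧ μ = ahCompactMeasure a x) ∧
      IsProbabilityMeasure μ ∧
      (∀ n ∈ S, IsAdicDoublingOn n (Icc 0 1) μ) ∧
      ¬ IsDoublingOn (Icc 0 1) μ) := by
  refine ⟨⟨{μ | ∃ x, IsGoodSequence S x ∧ μ = ahMeasure a x},
    infinite_of_first_term _ fun x y hx _ hxy => ahMeasure_ne ha0 ha1 hx hxy, ?_⟩,
    ⟨{μ | ∃ x, IsGoodSequence S x ∧ μ = ahCompactMeasure a x},
    infinite_of_first_term _ fun x y hx hy hxy => ahCompactMeasure_ne ha0 ha1 hx hy hxy, ?_⟩⟩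
  · rintro _ ⟨x, hx, rfl⟩
    exact ⟨⟨x, fun α hα => hx.isGoodScale hS hα, rfl⟩, ahMeasure_isLocallyFinite ha0 ha1 hx,
      fun n hn => ahMeasure_isAdicDoublingOn ha0 ha1 hx hn (hS n hn),
      ahMeasure_not_isDoublingOn ha0 ha1 hx⟩
  · rintro _ ⟨x, hx, rfl⟩
    exact ⟨⟨x, fun α hα => hx.isGoodScale hS hα,
      fun α hα => le_trans (by omega) (hx.gap α hα), rfl⟩,
      ahCompactMeasure_isProbability ha0 ha1 hx,
      fun n hn => ahCompactMeasure_isAdicDoublingOn ha0 ha1 hx hn (hS n hn),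
      ahCompactMeasure_not_isDoublingOn ha0 ha1 hx⟩
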